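/- **Setting.** Let $0<T<\infty$ and let $u,v$ be complex functions on $\{x\ge 0,\ 0\le t\le T\}$, of class $C^2$ up to the boundary, with $u,v,u_x,v_x=O((1+x)^{-2})$ uniformly in $t\in[0,T]$, which for $x>0$, $0<t<T$ satisfy $$iu_t+u_{xx}+2(|u|^2+|v|^2)u+i[(|u|^2+|v|^2)u]_x=0,\qquad iv_t+v_{xx}+2(|u|^2+|v|^2)v+i[(|u|^2+|v|^2)v]_x=0 .$$ For $\lambda\in\mathbb C$ put $k=\lambda^2+1$, $\Lambda=\mathrm{diag}(-1,1,1)$, and let $l_i$, $z_i$ be the diagonal entries of $-ik\Lambda$ and $2ik^2\Lambda$. Put $V_1=\lambda U_1$, $V_2=-2\lambda^3U_1+i\lambda^2U_2-\lambda U_3$, where, with $q=|u|^2+|v|^2$ and $*$ the complex conjugate, $$U_1=\begin{pmatrix}0&u&v\\u^*&0&0\\v^*&0&0\end{pmatrix},\quad U_2=\begin{pmatrix}-q&0&0\\0&|u|^2&u^*v\\0&uv^*&|v|^2\end{pmatrix},\quad U_3=\begin{pmatrix}0&2u+uq-iu_x&2v+vq-iv_x\\2u^*+u^*q+iu_x^*&0&0\\2v^*+v^*q+iv_x^*&0&0\end{pmatrix}.$$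 Consider the Lax pair $$\mu_x+ik[\Lambda,\mu]=V_1\mu,\qquad \mu_t-2ik^2[\Lambda,\mu]=V_2\mu \tag{L}$$ and the contours $\gamma_1:(0,T)\to(0,t)\to(x,t)$, $\gamma_2:(0,0)\to(0,t)\to(x,t)$, $\gamma_3:(\infty,t)\to(x,t)$. A column $j$ of a solution of (L) is said to be *normalized by the contours* $c_1,c_2,c_3$ if it is continuous on the closed half-strip and satisfies, for $i=1,2,3$, $$\mu_{ij}(x,t)=\delta_{ij}+\int_{c_i}e^{(l_i-l_j)(x-\xi)+(z_i-z_j)(t-\tau)}\big[(V_1\,d\xi+V_2\,d\tau)\mu\big]_{ij}(\xi,\tau).$$ * $\mu_1$ is the solution of (L) all of whose columns are normalized by $\gamma_1$ (for all $\lambda$), and $S(\lambda)=\mu_1(0,0,\lambda)$. * $\mu_3$ is the solution of (L) whose columns are bounded and normalized by $\gamma_3$: the first column for $\mathrm{Im}\,k\ge 0$, the second and third for $\mathrm{Im}\,k\le0$; and $s(\lambda)=\mu_3(0,0,\lambda)$. * $\mu_3^A$ is the analogous bounded solution normalized by $\gamma_3$ of the adjugated system, in which $l_i,z_i,V_1,V_2$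 are replaced by $-l_i,-z_i,-V_1^T,-V_2^T$: its first column is defined for $\mathrm{Im}\,k\le0$, its second and third for $\mathrm{Im}\,k\ge0$. Put $s^A(\lambda)=\mu_3^A(0,0,\lambda)$ and $m_{ij}(s)=(-1)^{i+j}(s^A)_{ij}$, the $(i,j)$ minor of $s$ (this is how the minors of $s$ are understood where $s$ is only partially defined). * $S^A$ is the cofactor matrix of $S$ and $M_{ij}(S)$ the $(i,j)$ minor of $S$. In particular $m_{11}(s)=(s^A)_{11}$. Let $$D_1:\ \mathrm{Re}\,l_1<\mathrm{Re}\,l_2,\ \mathrm{Re}\,z_1>\mathrm{Re}\,z_2;\qquad D_2:\ \mathrm{Re}\,l_1<\mathrm{Re}\,l_2,\ \mathrm{Re}\,z_1<\mathrm{Re}\,z_2;$$ $$D_3:\ \mathrm{Re}\,l_1>\mathrm{Re}\,l_2,\ \mathrm{Re}\,z_1>\mathrm{Re}\,z_2;\qquad D_4:\ \mathrm{Re}\,l_1>\mathrm{Re}\,l_2,\ \mathrm{Re}\,z_1<\mathrm{Re}\,z_2.$$ **Assumption on the zeros.** There are integers $0\le n_0\le n_1\le n_2\le N$ and distinct points $\lambda_1,\dots,\lambda_N$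 such that the zeros of $(s^TS^A)_{11}$ in $D_1$ are exactly the $\lambda_j$ with $1\le j\le n_0$, those of $s_{11}$ in $D_2$ exactly the $\lambda_j$ with $n_0<j\le n_1$, those of $m_{11}(s)$ in $D_3$ exactly the $\lambda_j$ with $n_1<j\le n_2$, and those of $(S^Ts^A)_{11}$ in $D_4$ exactly the $\lambda_j$ with $n_2<j\le N$. All these zeros are simple, and these functions have no zeros on the boundaries of $D_1,D_2,D_3,D_4$ respectively. **The function $M$.** For $\lambda\in D_1\cup D_2\cup D_3\cup D_4$, $\lambda\notin\{\lambda_1,\dots,\lambda_N\}$, let $M(x,t,\lambda)$ be a bounded (in $(x,t)$) solution of (L) whose column $j$ is normalized, for each $j$, by the contours $$c_i=\begin{cases}\gamma_1&\text{if }\mathrm{Re}\,l_i<\mathrm{Re}\,l_j\text{ and }\mathrm{Re}\,z_i\ge\mathrm{Re}\,z_j,\\ \gamma_2&\text{if }\mathrm{Re}\,l_i<\mathrm{Re}\,l_j\text{ and }\mathrm{Re}\,z_i<\mathrm{Re}\,z_j,\\ \gamma_3&\text{if }\mathrm{Re}\,l_i\ge\mathrm{Re}\,l_j.\end{cases}$$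 **Claim.** Write $[M]_j$ for the $j$-th column of $M$, $\dot f=df/d\lambda$ and $\theta_{ij}(x,t,\lambda)=(l_i-l_j)x+(z_i-z_j)t$, so that $\theta_{13}=-\theta_{31}=2ikx-4ik^2t$. For all $x\ge0$, $t\in[0,T]$ the following holds whenever the denominators on the right do not vanish. The columns of $M$ on the left are meromorphic at $\lambda_j$ with at most a simple pole. The columns on the right are meromorphic at $\lambda_j$ with at most a removable singularity there, and $[M(\lambda_j)]_i$ denotes the limit of $[M(x,t,\lambda)]_i$ as $\lambda\to\lambda_j$. All functions on the right are evaluated at $\lambda_j$. For $1\le j\le n_0$ ($\lambda_j\in D_1$): $$\operatorname*{Res}_{\lambda=\lambda_j}[M]_2=\frac{m_{33}(s)M_{11}(S)-m_{13}(s)M_{31}(S)}{\dot{(s^TS^A)_{11}}\,s_{21}}e^{\theta_{13}}[M(\lambda_j)]_1,\qquad \operatorname*{Res}_{\lambda=\lambda_j}[M]_3=\frac{m_{32}(s)M_{11}(S)-m_{12}(s)M_{31}(S)}{\dot{(s^TS^A)_{11}}\,s_{21}}e^{\theta_{13}}[M(\lambda_j)]_1 .$$ For $n_0<j\le n_1$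 ($\lambda_j\in D_2$): $$\operatorname*{Res}_{\lambda=\lambda_j}[M]_2=\frac{m_{33}(s)}{\dot s_{11}\,s_{21}}e^{\theta_{13}}[M(\lambda_j)]_1,\qquad \operatorname*{Res}_{\lambda=\lambda_j}[M]_3=\frac{m_{32}(s)}{\dot s_{11}\,s_{21}}e^{\theta_{13}}[M(\lambda_j)]_1 .$$ For $n_1<j\le n_2$ ($\lambda_j\in D_3$): $$\operatorname*{Res}_{\lambda=\lambda_j}[M]_1=\frac{s_{33}[M(\lambda_j)]_2-s_{32}[M(\lambda_j)]_3}{\dot{m_{11}(s)}\,m_{21}(s)}e^{\theta_{31}} .$$ For $n_2<j\le N$ ($\lambda_j\in D_4$): $$\operatorname*{Res}_{\lambda=\lambda_j}[M]_1=\frac{s_{33}S_{21}-s_{23}S_{31}}{\dot{(S^Ts^A)_{11}}\,m_{11}(s)}e^{\theta_{31}}[M(\lambda_j)]_2+\frac{s_{22}S_{31}-s_{32}S_{21}}{\dot{(S^Ts^A)_{11}}\,m_{11}(s)}e^{\theta_{31}}[M(\lambda_j)]_3 .$$ -/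

import Mathlib

open Complex Matrix Set Filter Topology MeasureTheory

noncomputable section

namespace CMNLS

/-- Partial derivative in `x` on the closed half-line (one-sided at `x = 0`). -/
def dx (f : ℝ → ℝ → ℂ) (x t : ℝ) : ℂ := derivWithin (fun y => f y t) (Ici 0) x

/-- Partial derivative in `t` on `[0, T]` (one-sided at the end points). -/
def dt (T : ℝ) (f : ℝ → ℝ → ℂ) (x t : ℝ) : ℂ := derivWithin (fun τ => f x τ) (Icc 0 T) t

/-- The closed half-strip `0 ≤ x < ∞`, `0 ≤ t ≤ T`. -/
def strip (T : ℝ) : Set (ℝ × ℝ) := Ici 0 ×ˢ Icc 0 T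

/-- `|u|² + |v|²`. -/
def density (u v : ℝ → ℝ → ℂ) (x t : ℝ) : ℂ := ((‖u x t‖ ^ 2 + ‖v x t‖ ^ 2 : ℝ) : ℂ)

/-- `(u, v)` is a solution, of class `C²` up to the boundary and decaying in `x`, of the coupled
modified nonlinear Schrödinger equations with `δ = 2`, `γ = 1` on the half-strip. -/
structure IsSolution (T : ℝ) (u v : ℝ → ℝ → ℂ) : Prop where
  smooth_u : ContDiffOn ℝ 2 (fun p : ℝ × ℝ => u p.1 p.2) (strip T)
  smooth_v : ContDiffOn ℝ 2 (fun p : ℝ × ℝ => v p.1 p.2) (strip T)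
  decay : ∃ C : ℝ, ∀ x t : ℝ, 0 ≤ x → t ∈ Icc 0 T →
    ‖u x t‖ ≤ C / (1 + x) ^ 2 ∧ ‖v x t‖ ≤ C / (1 + x) ^ 2 ∧
      ‖dx u x t‖ ≤ C / (1 + x) ^ 2 ∧ ‖dx v x t‖ ≤ C / (1 + x) ^ 2
  eq_u : ∀ x t : ℝ, 0 < x → t ∈ Ioo 0 T →
    I * dt T u x t + dx (dx u) x t + 2 * (density u v x t * u x t)
      + I * dx (fun y τ => density u v y τ * u y τ) x t = 0
  eq_v : ∀ x t : ℝ, 0 < x → t ∈ Ioo 0 T →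
    I * dt T v x t + dx (dx v) x t + 2 * (density u v x t * v x t)
      + I * dx (fun y τ => density u v y τ * v y τ) x t = 0

/-! ### The Lax pair -/

/-- `k = λ² + 1`. -/
def k (lam : ℂ) : ℂ := lam ^ 2 + 1

/-- The diagonal of `Λ = diag(-1, 1, 1)`. -/
def Lam : Fin 3 → ℂ := ![-1, 1, 1]

/-- The diagonal entries of `-ikΛ`. -/
def l (lam : ℂ) (i : Fin 3) : ℂ := -I * k lam * Lam i

/-- The diagonal entries of `2ik²Λ`. -/
def z (lam : ℂ) (i : Fin 3) : ℂ := 2 * I * k lam ^ 2 * Lam i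

def U1 (u v : ℝ → ℝ → ℂ) (x t : ℝ) : Matrix (Fin 3) (Fin 3) ℂ :=
  !![0, u x t, v x t;
     star (u x t), 0, 0;
     star (v x t), 0, 0]

def U2 (u v : ℝ → ℝ → ℂ) (x t : ℝ) : Matrix (Fin 3) (Fin 3) ℂ :=
  !![-density u v x t, 0, 0;
     0, star (u x t) * u x t, star (u x t) * v x t;
     0, u x t * star (v x t), star (v x t) * v x t]

def U3 (u v : ℝ → ℝ → ℂ) (x t : ℝ) : Matrix (Fin 3) (Fin 3) ℂ :=
  !![0, 2 * u x t + u x t * density u v x t - I * dx u x t,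
        2 * v x t + v x t * density u v x t - I * dx v x t;
     2 * star (u x t) + star (u x t) * density u v x t + I * star (dx u x t), 0, 0;
     2 * star (v x t) + star (v x t) * density u v x t + I * star (dx v x t), 0, 0]

/-- `V₁ = λ U₁`. -/
def V1 (u v : ℝ → ℝ → ℂ) (lam : ℂ) (x t : ℝ) : Matrix (Fin 3) (Fin 3) ℂ := lam • U1 u v x t

/-- `V₂ = -2λ³ U₁ + iλ² U₂ - λ U₃`. -/
def V2 (u v : ℝ → ℝ → ℂ) (lam : ℂ) (x t : ℝ) : Matrix (Fin 3) (Fin 3) ℂ :=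
  (-2 * lam ^ 3) • U1 u v x t + (I * lam ^ 2) • U2 u v x t - lam • U3 u v x t

/-! ### Contours, integral equations, eigenfunctions -/

/-- The three contours ending at `(x, t)`:
`γ₁` runs `(0, T) → (0, t) → (x, t)`, `γ₂` runs `(0, 0) → (0, t) → (x, t)`,
and `γ₃` runs `(∞, t) → (x, t)`. -/
inductive Contour
  | γ₁
  | γ₂
  | γ₃

/-- Row `i` of `∫_γ e^{((x-ξ) l + (t-τ) z)^} (P dξ + Q dτ) F`, where `f` is the column `j` of `F`;
the conjugation by the diagonal matrices multiplies the entry `(i, j)` by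
`e^{(l_i - l_j)(x-ξ) + (z_i - z_j)(t-τ)}`. -/
def contourIntegral (T : ℝ) (l z : Fin 3 → ℂ) (P Q : ℝ → ℝ → Matrix (Fin 3) (Fin 3) ℂ)
    (j : Fin 3) (f : ℝ → ℝ → Fin 3 → ℂ) (x t : ℝ) (i : Fin 3) : Contour → ℂ
  | .γ₁ =>
      (∫ τ in T..t, exp ((l i - l j) * (x : ℂ) + (z i - z j) * ((t : ℂ) - (τ : ℂ))) *
          (Q 0 τ *ᵥ f 0 τ) i)
        + ∫ ξ in (0 : ℝ)..x, exp ((l i - l j) * ((x : ℂ) - (ξ : ℂ))) * (P ξ t *ᵥ f ξ t) i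
  | .γ₂ =>
      (∫ τ in (0 : ℝ)..t, exp ((l i - l j) * (x : ℂ) + (z i - z j) * ((t : ℂ) - (τ : ℂ))) *
          (Q 0 τ *ᵥ f 0 τ) i)
        + ∫ ξ in (0 : ℝ)..x, exp ((l i - l j) * ((x : ℂ) - (ξ : ℂ))) * (P ξ t *ᵥ f ξ t) i
  | .γ₃ =>
      -∫ ξ in Ioi x, exp ((l i - l j) * ((x : ℂ) - (ξ : ℂ))) * (P ξ t *ᵥ f ξ t) i

/-- `f` is the column `j` of a solution `F` of the Lax pair
`F_x = [diag l, F] + P F`, `F_t = [diag z, F] + Q F`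
that satisfies the integral equation with contour `c i` in row `i`. -/
structure IsEigencolumn (T : ℝ) (l z : Fin 3 → ℂ) (P Q : ℝ → ℝ → Matrix (Fin 3) (Fin 3) ℂ)
    (c : Fin 3 → Contour) (j : Fin 3) (f : ℝ → ℝ → Fin 3 → ℂ) : Prop where
  cont : ContinuousOn (fun p : ℝ × ℝ => f p.1 p.2) (strip T)
  lax_x : ∀ x t : ℝ, 0 ≤ x → t ∈ Icc 0 T → ∀ i, HasDerivWithinAt (fun y => f y t i)
    ((l i - l j) * f x t i + (P x t *ᵥ f x t) i) (Ici 0) x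
  lax_t : ∀ x t : ℝ, 0 ≤ x → t ∈ Icc 0 T → ∀ i, HasDerivWithinAt (fun τ => f x τ i)
    ((z i - z j) * f x t i + (Q x t *ᵥ f x t) i) (Icc 0 T) t
  integral_eq : ∀ x t : ℝ, 0 ≤ x → t ∈ Icc 0 T → ∀ i,
    f x t i = (if i = j then 1 else 0) + contourIntegral T l z P Q j f x t i (c i)

def IsBounded (T : ℝ) (f : ℝ → ℝ → Fin 3 → ℂ) : Prop :=
  ∃ C : ℝ, ∀ x t : ℝ, 0 ≤ x → t ∈ Icc 0 T → ‖f x t‖ ≤ C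

/-- Eigencolumns of the Lax pair of the coupled modified nonlinear Schrödinger equations. -/
def IsLaxColumn (T : ℝ) (u v : ℝ → ℝ → ℂ) (lam : ℂ) (c : Fin 3 → Contour) (j : Fin 3)
    (f : ℝ → ℝ → Fin 3 → ℂ) : Prop :=
  IsEigencolumn T (l lam) (z lam) (V1 u v lam) (V2 u v lam) c j f

/-- Eigencolumns of the adjugate Lax pair
`F_x - ik[Λ, F] = -V₁ᵀ F`, `F_t + 2ik²[Λ, F] = -V₂ᵀ F`. -/
def IsAdjugateLaxColumn (T : ℝ) (u v : ℝ → ℝ → ℂ) (lam : ℂ) (c : Fin 3 → Contour) (j : Fin 3)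
    (f : ℝ → ℝ → Fin 3 → ℂ) : Prop :=
  IsEigencolumn T (-l lam) (-z lam) (fun x t => -(V1 u v lam x t)ᵀ)
    (fun x t => -(V2 u v lam x t)ᵀ) c j f

/-- `μ₁` is the eigenfunction normalized at `(0, T)`; it exists for all `λ`. -/
def IsMu1 (T : ℝ) (u v : ℝ → ℝ → ℂ) (μ : ℝ → ℝ → ℂ → Matrix (Fin 3) (Fin 3) ℂ) : Prop :=
  ∀ (lam : ℂ) (j : Fin 3),
    IsLaxColumn T u v lam (fun _ => .γ₁) j (fun x t i => μ x t lam i j)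

/-- `μ₃` is the eigenfunction normalized at `x = ∞`. Its column `j` is defined, as a bounded
solution, where `Re l_i ≥ Re l_j` for all `i`: the first column on the closure of `D₁ ∪ D₂`, the
second and the third on the closure of `D₃ ∪ D₄`. Elsewhere nothing is required of the entries. -/
def IsMu3 (T : ℝ) (u v : ℝ → ℝ → ℂ) (μ : ℝ → ℝ → ℂ → Matrix (Fin 3) (Fin 3) ℂ) : Prop :=
  ∀ (lam : ℂ) (j : Fin 3), (∀ i, (l lam j).re ≤ (l lam i).re) →
    IsLaxColumn T u v lam (fun _ => .γ₃) j (fun x t i => μ x t lam i j) ∧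
      IsBounded T (fun x t i => μ x t lam i j)

/-- `μ₃ᴬ`, the adjugated eigenfunction normalized at `x = ∞`. Its first column is defined on the
closure of `D₃ ∪ D₄`, its second and third columns on the closure of `D₁ ∪ D₂`. It is the cofactor
matrix of `μ₃` wherever all columns of `μ₃` are available. -/
def IsMu3A (T : ℝ) (u v : ℝ → ℝ → ℂ) (μ : ℝ → ℝ → ℂ → Matrix (Fin 3) (Fin 3) ℂ) : Prop :=
  ∀ (lam : ℂ) (j : Fin 3), (∀ i, (l lam i).re ≤ (l lam j).re) →
    IsAdjugateLaxColumn T u v lam (fun _ => .γ₃) j (fun x t i => μ x t lam i j) ∧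
      IsBounded T (fun x t i => μ x t lam i j)

/-! ### The domains and the sectional eigenfunction -/

def D₁ : Set ℂ := {lam | (l lam 0).re < (l lam 1).re ∧ (z lam 1).re < (z lam 0).re}
def D₂ : Set ℂ := {lam | (l lam 0).re < (l lam 1).re ∧ (z lam 0).re < (z lam 1).re}
def D₃ : Set ℂ := {lam | (l lam 1).re < (l lam 0).re ∧ (z lam 1).re < (z lam 0).re}
def D₄ : Set ℂ := {lam | (l lam 1).re < (l lam 0).re ∧ (z lam 0).re < (z lam 1).re}

open Classical in
/-- The contour `γ^n_{ij}` for `λ ∈ D_n`. -/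
def sectionContour (lam : ℂ) (i j : Fin 3) : Contour :=
  if (l lam i).re < (l lam j).re then
    if (z lam j).re ≤ (z lam i).re then .γ₁ else .γ₂
  else .γ₃

/-- `M` is the sectional eigenfunction, equal to `M_n` on `D_n`, away from the set `E` of
singularities. -/
def IsSectionalM (T : ℝ) (u v : ℝ → ℝ → ℂ) (E : Set ℂ)
    (M : ℝ → ℝ → ℂ → Matrix (Fin 3) (Fin 3) ℂ) : Prop :=
  ∀ lam ∈ D₁ ∪ D₂ ∪ D₃ ∪ D₄, lam ∉ E → ∀ j : Fin 3,
    IsLaxColumn T u v lam (fun i => sectionContour lam i j) j (fun x t i => M x t lam i j) ∧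
      IsBounded T (fun x t i => M x t lam i j)

/-! ### Spectral functions -/

/-- The `(i, j)` minor: delete row `i` and column `j`. -/
def minor (B : Matrix (Fin 3) (Fin 3) ℂ) (i j : Fin 3) : ℂ :=
  (B.submatrix i.succAbove j.succAbove).det

/-- The cofactor matrix `Bᴬ`. -/
def cofactor (B : Matrix (Fin 3) (Fin 3) ℂ) : Matrix (Fin 3) (Fin 3) ℂ :=
  Matrix.of fun i j => (-1) ^ ((i : ℕ) + (j : ℕ)) * minor B i j

/-- The value at `(x, t) = (0, 0)`: `s`, `S` and `sᴬ` for `μ₃`, `μ₁` and `μ₃ᴬ`. -/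
def spec (μ : ℝ → ℝ → ℂ → Matrix (Fin 3) (Fin 3) ℂ) (lam : ℂ) : Matrix (Fin 3) (Fin 3) ℂ :=
  μ 0 0 lam

/-- The minor `m_{ij}` read off from a cofactor matrix. -/
def minorOf (sA : ℂ → Matrix (Fin 3) (Fin 3) ℂ) (i j : Fin 3) (lam : ℂ) : ℂ :=
  (-1) ^ ((i : ℕ) + (j : ℕ)) * sA lam i j

/-- `(sᵀ Sᴬ)₁₁`. -/
def sTSA (s S : ℂ → Matrix (Fin 3) (Fin 3) ℂ) (lam : ℂ) : ℂ := ((s lam)ᵀ * cofactor (S lam)) 0 0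

/-- `(Sᵀ sᴬ)₁₁`. -/
def STsA (S sA : ℂ → Matrix (Fin 3) (Fin 3) ℂ) (lam : ℂ) : ℂ := ((S lam)ᵀ * sA lam) 0 0

/-- The zeros of `f` in `D` are exactly the `λ_j`, `j ∈ J`, they are simple, and `f` has no zero on
the boundary of `D`. -/
structure SimpleZerosIn (f : ℂ → ℂ) (D : Set ℂ) (lam : ℕ → ℂ) (J : Set ℕ) : Prop where
  zeros : {w ∈ D | f w = 0} = lam '' J
  simple : ∀ j ∈ J, deriv f (lam j) ≠ 0
  boundary : ∀ w ∈ frontier D, f w ≠ 0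

/-- The standing assumption on the zeros `λ₁, …, λ_N`. -/
structure ZeroAssumption (s S sA : ℂ → Matrix (Fin 3) (Fin 3) ℂ) (n₀ n₁ n₂ N : ℕ)
    (lam : ℕ → ℂ) : Prop where
  le₀₁ : n₀ ≤ n₁
  le₁₂ : n₁ ≤ n₂
  le₂ : n₂ ≤ N
  distinct : InjOn lam (Icc 1 N)
  zeros₁ : SimpleZerosIn (sTSA s S) D₁ lam (Icc 1 n₀)
  zeros₂ : SimpleZerosIn (fun w => s w 0 0) D₂ lam (Ioc n₀ n₁)
  zeros₃ : SimpleZerosIn (minorOf sA 0 0) D₃ lam (Ioc n₁ n₂)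
  zeros₄ : SimpleZerosIn (STsA S sA) D₄ lam (Ioc n₂ N)

/-! ### Residues -/

/-- `θ_{ij}(x, t, λ) = (l_i - l_j) x + (z_i - z_j) t`. -/
def θ (i j : Fin 3) (x t : ℝ) (lam : ℂ) : ℂ :=
  (l lam i - l lam j) * (x : ℂ) + (z lam i - z lam j) * (t : ℂ)

/-- The column `j` of `M(x, t, ·)`. -/
def column (M : ℝ → ℝ → ℂ → Matrix (Fin 3) (Fin 3) ℂ) (x t : ℝ) (j : Fin 3) (lam : ℂ) :
    Fin 3 → ℂ := fun i => M x t lam i j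

/-- `f` is meromorphic at `w`, regular there up to a removable singularity, with value `a`. -/
def HasRegularValue (f : ℂ → Fin 3 → ℂ) (w : ℂ) (a : Fin 3 → ℂ) : Prop :=
  MeromorphicAt f w ∧ Tendsto f (𝓝[≠] w) (𝓝 a)

/-- `f` is meromorphic at `w` with at most a simple pole, and its residue is `r`. -/
def HasSimpleResidue (f : ℂ → Fin 3 → ℂ) (w : ℂ) (r : Fin 3 → ℂ) : Prop :=
  MeromorphicAt f w ∧ Tendsto (fun ζ => (ζ - w) • f ζ) (𝓝[≠] w) (𝓝 r)

end CMNLS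

end

/-! In (x, t) everything is a linear differential equation with trace-free coefficients. `μ₁` is
therefore a fundamental solution of determinant 1, and every column of index j is `propagator μ₁ x t
j λ` applied to its value at the origin (`IsMu1.eq_propagator_mulVec`). The propagator is entire in
λ, and changing j only multiplies it by an exponential e^θ (`propagator_eq_smul`). The residues thus
reduce to vectors at (0, 0), depending on λ alone.

At the origin the contours become linear conditions, because the pairing of a column with a column
of the adjugate system is constant up to an explicit exponential. A row on γ₃ is evaluated at x = ∞
and a row on γ₁ at (0, T); a row on γ₂ is prescribed at (0, 0) itself. Write e₁ for the first unit
vector.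

Where Re l₁ < Re l₂, let b, c be the second and third columns of sᴬ, and let a be the first column
of Sᴬ in D₁ and e₁ in D₂. Then the first column of M is that of s, which equals b × c by uniqueness
at infinity. The other two are orthogonal to a and dual to b, c. Cramer's rule gives φ[M]₂ = c × a
and φ[M]₃ = a × b with φ = a · (b × c), which is (sᵀSᴬ)₁₁ or s₁₁. At a zero of φ the vectors a, b, c
are dependent, so c × a and a × b are multiples of b × c whenever its second entry s₂₁ is nonzero;
comparing second entries gives the factor.

Where Re l₂ < Re l₁, let p, q be the second and third columns of s, so that the first column of sᴬ
is p × q. Then [M]₂ = p and [M]₃ = q, while [M]₁ is a multiple of b, now e₁ in D₃ and the first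
column of S in D₄, and pairs to 1 with p × q. Hence φ[M]₁ = b with φ = b · (p × q). At a zero of φ
the vector b is an explicit combination of p and q.

What remains is analyticity in λ. For S it is parameter dependence on compact intervals. For s and
sᴬ the columns are locally uniform limits of solutions normalized at x = n, and an energy estimate
controls the error at x = 0 (`differentiableOn_jostColumn`). -/

/-! ### Holomorphic dependence of linear differential equations on a parameter -/

section LinearODE

variable {E : Type*} [NormedAddCommGroup E] [NormedSpace ℂ E]

/-- Grönwall's inequality for an inhomogeneous linear differential equation. -/
theorem norm_le_of_linear_ode {a b K ε : ℝ} (hK : 1 ≤ K) {A : ℝ → E →L[ℂ] E} {r g : ℝ → E}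
    (hA : ∀ x ∈ Icc a b, ‖A x‖ ≤ K) (hr : ∀ x ∈ Icc a b, ‖r x‖ ≤ ε)
    (hg : ∀ x ∈ Icc a b, HasDerivWithinAt g (A x (g x) + r x) (Icc a b) x) :
    ∀ x ∈ Icc a b, ‖g x‖ ≤ (‖g a‖ + ε) * Real.exp (K * (b - a)) := by
  intro x hx
  -- The assumption 1 ≤ K only serves to replace ε / K by ε in the Grönwall bound.
  have hK0 : (0 : ℝ) < K := by linarith
  have hε : 0 ≤ ε := (norm_nonneg _).trans (hr x hx)
  have h := norm_le_gronwallBound_of_norm_deriv_right_le (δ := ‖g a‖) (K := K) (ε := ε)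
    (fun y hy => (hg y hy).continuousWithinAt)
    (fun y hy => (hg y (Ico_subset_Icc_self hy)).mono_of_mem_nhdsWithin
      (Icc_mem_nhdsGE_of_mem hy)) le_rfl
    (fun y hy => by
      have hy' := Ico_subset_Icc_self hy
      calc ‖A y (g y) + r y‖ ≤ ‖A y (g y)‖ + ‖r y‖ := norm_add_le _ _
        _ ≤ K * ‖g y‖ + ε := by
          gcongr
          · exact ((A y).le_opNorm _).trans (by gcongr; exact hA y hy')
          · exact hr y hy') x hx
  refine h.trans ?_
  rw [gronwallBound_of_K_ne_0 hK0.ne']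
  have hle : Real.exp (K * (x - a)) ≤ Real.exp (K * (b - a)) := by
    gcongr
    exact hx.2
  have h1 : (1 : ℝ) ≤ Real.exp (K * (x - a)) :=
    Real.one_le_exp (mul_nonneg hK0.le (by linarith [hx.1]))
  have h2 : ε / K ≤ ε := div_le_self hε hK
  have h3 : ε / K * (Real.exp (K * (x - a)) - 1) ≤ ε * Real.exp (K * (b - a)) :=
    mul_le_mul h2 (by linarith) (by linarith) hε
  have h4 : ‖g a‖ * Real.exp (K * (x - a)) ≤ ‖g a‖ * Real.exp (K * (b - a)) := by gcongr
  simp only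
  linarith

/-- If the coefficients of a linear differential equation and the initial value are complex
differentiable at a parameter, the latter uniformly on the interval, then so is the solution. -/
theorem differentiableAt_of_linear_ode [CompleteSpace E] {a b : ℝ} (hab : a ≤ b) {K : ℝ}
    {w₀ : ℂ} {A : ℂ → ℝ → E →L[ℂ] E} {A' : ℝ → E →L[ℂ] E} {f : ℂ → ℝ → E}
    (hA : ∀ x ∈ Icc a b, ‖A w₀ x‖ ≤ K) (hA' : ∀ x ∈ Icc a b, ‖A' x‖ ≤ K)
    (hd : ∀ ε > 0, ∀ᶠ w in 𝓝 w₀, ∀ x ∈ Icc a b,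
      ‖A w x - A w₀ x - (w - w₀) • A' x‖ ≤ ε * ‖w - w₀‖)
    (hf : ∀ w, ∀ x ∈ Icc a b, HasDerivWithinAt (f w) (A w x (f w x)) (Icc a b) x)
    (h0 : DifferentiableAt ℂ (fun w => f w a) w₀) :
    DifferentiableAt ℂ (fun w => f w b) w₀ := by
  have ha : a ∈ Icc a b := left_mem_Icc.2 hab
  have hb : b ∈ Icc a b := right_mem_Icc.2 hab
  have hK : 0 ≤ K := (norm_nonneg _).trans (hA a ha)
  obtain ⟨d, hd0⟩ : ∃ d, HasDerivAt (fun w => f w a) d w₀ := ⟨_, h0.hasDerivAt⟩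
  have hdA : ∀ᶠ w in 𝓝 w₀, ∀ x ∈ Icc a b, ‖A w x - A w₀ x‖ ≤ (K + 1) * ‖w - w₀‖ := by
    filter_upwards [hd 1 one_pos] with w hw x hx
    calc ‖A w x - A w₀ x‖ = ‖(A w x - A w₀ x - (w - w₀) • A' x) + (w - w₀) • A' x‖ := by
          rw [sub_add_cancel]
      _ ≤ 1 * ‖w - w₀‖ + ‖w - w₀‖ * K := by
          refine (norm_add_le _ _).trans (add_le_add (hw x hx) ?_)
          rw [norm_smul]
          gcongr
          exact hA' x hx
      _ = (K + 1) * ‖w - w₀‖ := by ring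
  have hsub : Tendsto (fun w => ‖w - w₀‖) (𝓝 w₀) (𝓝 0) := by
    have : Continuous fun w : ℂ => ‖w - w₀‖ := by fun_prop
    simpa using this.tendsto w₀
  have hcont : Tendsto (fun w => ‖f w a - f w₀ a‖) (𝓝 w₀) (𝓝 0) := by
    have := (h0.continuousAt.tendsto.sub_const (f w₀ a)).norm
    simpa using this
  -- Near w₀ the operators `A w` are bounded by 2K + 1, so Grönwall bounds the solutions uniformly
  -- in w; continuity in w and convergence of the forcing terms build on this bound.
  obtain ⟨F, hF0, hF⟩ : ∃ F, 0 < F ∧ ∀ᶠ w in 𝓝 w₀, ∀ x ∈ Icc a b, ‖f w x‖ ≤ F := by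
    refine ⟨(‖f w₀ a‖ + 1 + 0) * Real.exp ((2 * K + 2) * (b - a)), by positivity, ?_⟩
    filter_upwards [hdA, hsub.eventually_lt_const one_pos, hcont.eventually_lt_const one_pos]
      with w h1 h2 h3 x hx
    refine (norm_le_of_linear_ode (K := 2 * K + 2) (ε := 0) (by linarith) (A := A w)
      (r := fun _ => 0) (fun y hy => ?_) (by simp)
      (fun y hy => by simpa using hf w y hy) x hx).trans ?_
    · calc ‖A w y‖ = ‖(A w y - A w₀ y) + A w₀ y‖ := by rw [sub_add_cancel]
        _ ≤ (K + 1) * 1 + K := (norm_add_le _ _).trans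
            (add_le_add ((h1 y hy).trans (by gcongr)) (hA y hy))
        _ ≤ 2 * K + 2 := by linarith
    · gcongr
      calc ‖f w a‖ = ‖f w₀ a + (f w a - f w₀ a)‖ := by rw [add_sub_cancel]
        _ ≤ ‖f w₀ a‖ + 1 := (norm_add_le _ _).trans (by gcongr)
  set G : ℝ := Real.exp ((K + 1) * (b - a)) with hG
  have hG0 : 0 < G := Real.exp_pos _
  have hη : ∀ ε > 0, ∀ᶠ w in 𝓝 w₀, ∀ x ∈ Icc a b, ‖f w x - f w₀ x‖ ≤ ε := by
    intro ε hε
    have hlim : Tendsto (fun w => (‖f w a - f w₀ a‖ + (K + 1) * ‖w - w₀‖ * F) * G)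
        (𝓝 w₀) (𝓝 0) := by
      simpa using (hcont.add ((hsub.const_mul (K + 1)).mul_const F)).mul_const G
    filter_upwards [hdA, hF, hlim.eventually_lt_const hε] with w h1 h2 h3 x hx
    refine (norm_le_of_linear_ode (K := K + 1) (by linarith) (A := A w₀)
      (r := fun y => (A w y - A w₀ y) (f w y)) (g := fun y => f w y - f w₀ y)
      (ε := (K + 1) * ‖w - w₀‖ * F)
      (fun y hy => (hA y hy).trans (by linarith)) (fun y hy => ?_) (fun y hy => ?_) x hx).trans h3.le
    · exact ((A w y - A w₀ y).le_opNorm _).trans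
        (mul_le_mul (h1 y hy) (h2 y hy) (norm_nonneg _) (by positivity))
    · refine ((hf w y hy).sub (hf w₀ y hy)).congr_deriv ?_
      simp only [map_sub, _root_.sub_apply]
      abel
  -- The difference quotient of the solution satisfies the equation at w₀ with a forcing term; this
  -- term converges uniformly on the interval to `A' x (f w₀ x)`.
  have hρ : ∀ ε > 0, ∀ᶠ w in 𝓝[≠] w₀, ∀ x ∈ Icc a b,
      ‖(w - w₀)⁻¹ • (A w x - A w₀ x) (f w x) - A' x (f w₀ x)‖ ≤ ε := by
    intro ε hε
    have h1 := hd (ε / (2 * F)) (by positivity)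
    have h2 := hη (ε / (2 * (K + 1))) (by positivity)
    filter_upwards [nhdsWithin_le_nhds h1, nhdsWithin_le_nhds h2, nhdsWithin_le_nhds hF,
      self_mem_nhdsWithin] with w h1 h2 h3 hw x hx
    have hw' : w - w₀ ≠ 0 := sub_ne_zero.2 hw
    have heq : (w - w₀)⁻¹ • (A w x - A w₀ x) (f w x) - A' x (f w₀ x) =
        (w - w₀)⁻¹ • (A w x - A w₀ x - (w - w₀) • A' x) (f w x) + A' x (f w x - f w₀ x) := by
      simp only [map_sub, _root_.sub_apply, _root_.smul_apply, smul_sub,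
        smul_smul, inv_mul_cancel₀ hw', one_smul]
      abel
    rw [heq]
    calc _ ≤ ‖w - w₀‖⁻¹ * ((ε / (2 * F) * ‖w - w₀‖) * F) + (K + 1) * (ε / (2 * (K + 1))) := by
          refine (norm_add_le _ _).trans (add_le_add ?_ ?_)
          · rw [norm_smul, norm_inv]
            gcongr
            exact (ContinuousLinearMap.le_opNorm _ _).trans
              (mul_le_mul (h1 x hx) (h3 x hx) (norm_nonneg _) (by positivity))
          · exact ((A' x).le_opNorm _).trans
              (mul_le_mul ((hA' x hx).trans (by linarith)) (h2 x hx) (norm_nonneg _)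
                (by positivity))
      _ = ε := by
          have : ‖w - w₀‖ ≠ 0 := norm_ne_zero_iff.2 hw'
          field_simp
          ring
  have hq : ∀ ε > 0, ∀ᶠ w in 𝓝[≠] w₀, ‖(w - w₀)⁻¹ • (f w a - f w₀ a) - d‖ ≤ ε := by
    intro ε hε
    have := (tendsto_iff_norm_sub_tendsto_zero.1 (hasDerivAt_iff_tendsto_slope.1 hd0))
    filter_upwards [this.eventually_lt_const hε] with w hw
    simpa [slope_def_module] using hw.le
  -- The derivative is obtained without solving the variational equation: the difference of two
  -- difference quotients solves the equation at w₀ with small forcing and small initial value, so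
  -- the quotients are Cauchy and completeness provides the limit. Four errors ε / (5G), amplified
  -- by at most G, add up to 4ε / 5.
  have hcauchy : Cauchy (map (fun w => (w - w₀)⁻¹ • (f w b - f w₀ b)) (𝓝[≠] w₀)) := by
    refine Metric.cauchy_iff.2 ⟨inferInstance, fun ε hε => ?_⟩
    have hε' : 0 < ε / (5 * G) := by positivity
    refine ⟨_, image_mem_map ((hρ _ hε').and (hq _ hε')), ?_⟩
    rintro _ ⟨w, ⟨hw1, hw2⟩, rfl⟩ _ ⟨w', ⟨hw1', hw2'⟩, rfl⟩
    have key := norm_le_of_linear_ode (K := K + 1) (ε := ε / (5 * G) + ε / (5 * G)) (by linarith)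
      (A := A w₀)
      (g := fun y => (w - w₀)⁻¹ • (f w y - f w₀ y) - (w' - w₀)⁻¹ • (f w' y - f w₀ y))
      (r := fun y => ((w - w₀)⁻¹ • (A w y - A w₀ y) (f w y) - A' y (f w₀ y)) -
        ((w' - w₀)⁻¹ • (A w' y - A w₀ y) (f w' y) - A' y (f w₀ y)))
      (fun y hy => (hA y hy).trans (by linarith))
      (fun y hy => (norm_sub_le _ _).trans (add_le_add (hw1 y hy) (hw1' y hy)))
      (fun y hy => by
        refine ((((hf w y hy).sub (hf w₀ y hy)).const_smul (w - w₀)⁻¹).sub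
          (((hf w' y hy).sub (hf w₀ y hy)).const_smul (w' - w₀)⁻¹)).congr_deriv ?_
        simp only [map_sub, map_smul, _root_.sub_apply, smul_sub]
        abel) b hb
    have hinit : ‖(w - w₀)⁻¹ • (f w a - f w₀ a) - (w' - w₀)⁻¹ • (f w' a - f w₀ a)‖ ≤
        ε / (5 * G) + ε / (5 * G) := by
      rw [← sub_sub_sub_cancel_right _ _ d]
      exact (norm_sub_le _ _).trans (add_le_add hw2 hw2')
    rw [dist_eq_norm]
    refine key.trans_lt ?_
    calc _ ≤ ((ε / (5 * G) + ε / (5 * G)) + (ε / (5 * G) + ε / (5 * G))) * G := by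
          rw [← hG]
          gcongr
      _ = 4 / 5 * ε := by field_simp; ring
      _ < ε := by linarith
  obtain ⟨D, hD⟩ := cauchy_map_iff_exists_tendsto.1 hcauchy
  have : HasDerivAt (fun w => f w b) D w₀ := by
    rw [hasDerivAt_iff_tendsto_slope]
    exact hD.congr fun w => by simp [slope_def_module]
  exact this.differentiableAt

/-- The solution of a linear differential equation is an entire function of a parameter if the
initial value and the scalar coefficients are. -/
theorem differentiable_of_linear_ode_sum [CompleteSpace E] {ι : Type*} [Fintype ι] {a b : ℝ}
    (hab : a ≤ b) {K : ℝ} {c : ι → ℂ → ℂ} (hc : ∀ n, Differentiable ℂ (c n))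
    {B : ι → ℝ → E →L[ℂ] E} (hB : ∀ n, ∀ x ∈ Icc a b, ‖B n x‖ ≤ K) {f : ℂ → ℝ → E}
    (hf : ∀ w, ∀ x ∈ Icc a b,
      HasDerivWithinAt (f w) (∑ n, c n w • B n x (f w x)) (Icc a b) x)
    (h0 : Differentiable ℂ (fun w => f w a)) : Differentiable ℂ (fun w => f w b) := by
  intro w₀
  have hbound : ∀ e : ι → ℂ, ∀ x ∈ Icc a b, ‖∑ n, e n • B n x‖ ≤ ∑ n, ‖e n‖ * K := by
    intro e x hx
    refine (norm_sum_le _ _).trans (Finset.sum_le_sum fun n _ => ?_)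
    rw [norm_smul]
    gcongr
    exact hB n x hx
  have h1 := hbound (fun n => c n w₀)
  have h2 := hbound (fun n => deriv (c n) w₀)
  refine differentiableAt_of_linear_ode hab (w₀ := w₀) (A := fun w x => ∑ n, c n w • B n x)
    (A' := fun x => ∑ n, deriv (c n) w₀ • B n x)
    (K := max (∑ n, ‖c n w₀‖ * K) (∑ n, ‖deriv (c n) w₀‖ * K))
    (fun x hx => (h1 x hx).trans (le_max_left _ _))
    (fun x hx => (h2 x hx).trans (le_max_right _ _)) ?_ (fun w x hx => ?_) (h0 w₀)
  · intro ε hε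
    -- The summand 1 keeps the divisor positive when K = 0 or ι is empty.
    set k : ℝ := Fintype.card ι * |K| + 1 with hk
    have hk0 : 0 < k := by positivity
    have hlit : ∀ᶠ w in 𝓝 w₀, ∀ n,
        ‖c n w - c n w₀ - (w - w₀) • deriv (c n) w₀‖ ≤ ε / k * ‖w - w₀‖ :=
      eventually_all.2 fun n =>
        ((hasDerivAt_iff_isLittleO.1 (hc n w₀).hasDerivAt).def (div_pos hε hk0))
    filter_upwards [hlit] with w hw x hx
    have heq : ∑ n, c n w • B n x - ∑ n, c n w₀ • B n x -
        (w - w₀) • ∑ n, deriv (c n) w₀ • B n x =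
        ∑ n, (c n w - c n w₀ - (w - w₀) • deriv (c n) w₀) • B n x := by
      simp only [sub_smul, Finset.sum_sub_distrib, Finset.smul_sum, smul_assoc]
    rw [heq]
    calc _ ≤ ∑ n, ‖c n w - c n w₀ - (w - w₀) • deriv (c n) w₀‖ * K := hbound _ x hx
      _ ≤ ∑ _n : ι, (ε / k * ‖w - w₀‖) * |K| := by
        refine Finset.sum_le_sum fun n _ => ?_
        exact (mul_le_mul_of_nonneg_left (le_abs_self K) (norm_nonneg _)).trans
          (mul_le_mul_of_nonneg_right (hw n) (abs_nonneg K))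
      _ = ε * ‖w - w₀‖ * ((k - 1) / k) := by
        rw [Finset.sum_const, Finset.card_univ, nsmul_eq_mul, hk]
        ring
      _ ≤ ε * ‖w - w₀‖ * 1 := by
        gcongr
        rw [div_le_one hk0]
        linarith
      _ = ε * ‖w - w₀‖ := mul_one _
  · refine (hf w x hx).congr_deriv ?_
    simp

end LinearODE

namespace CMNLS

/-! ### Columns of solutions of a first order system and of its adjugate -/

/-- `f` is the column `j` of a solution `F` of `F' = [diag l, F] + P F` on `s`. -/
def SolvesOn (l : Fin 3 → ℂ) (P : ℝ → Matrix (Fin 3) (Fin 3) ℂ) (j : Fin 3)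
    (f : ℝ → Fin 3 → ℂ) (s : Set ℝ) : Prop :=
  ∀ x ∈ s, ∀ i,
    HasDerivWithinAt (fun y => f y i) ((l i - l j) * f x i + (P x *ᵥ f x) i) s x

section System

variable {l : Fin 3 → ℂ} {P : ℝ → Matrix (Fin 3) (Fin 3) ℂ} {s : Set ℝ}

theorem SolvesOn.add {j : Fin 3} {f g : ℝ → Fin 3 → ℂ} (hf : SolvesOn l P j f s)
    (hg : SolvesOn l P j g s) : SolvesOn l P j (fun x => f x + g x) s := fun x hx i => by
  refine ((hf x hx i).add (hg x hx i)).congr_deriv ?_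
  simp only [mulVec_add, Pi.add_apply]
  ring

theorem SolvesOn.sub {j : Fin 3} {f g : ℝ → Fin 3 → ℂ} (hf : SolvesOn l P j f s)
    (hg : SolvesOn l P j g s) : SolvesOn l P j (fun x => f x - g x) s := fun x hx i => by
  refine ((hf x hx i).sub (hg x hx i)).congr_deriv ?_
  simp only [mulVec_sub, Pi.sub_apply]
  ring

theorem hasDerivWithinAt_exp_mul_ofReal (c : ℂ) (s : Set ℝ) (x : ℝ) :
    HasDerivWithinAt (fun y : ℝ => exp (c * y)) (c * exp (c * x)) s x := by
  have h1 : HasDerivAt (fun y : ℝ => c * (y : ℂ)) c x := by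
    simpa using (hasDerivAt_id x).ofReal_comp.const_mul c
  exact (h1.cexp.congr_deriv (mul_comm _ _)).hasDerivWithinAt

/-- The index of a column is changed by an exponential factor. -/
theorem SolvesOn.change_index {m : Fin 3} {f : ℝ → Fin 3 → ℂ} (hf : SolvesOn l P m f s)
    (j : Fin 3) (c : ℂ) :
    SolvesOn l P j (fun x => (c * exp ((l m - l j) * x)) • f x) s := fun x hx i => by
  refine (((hasDerivWithinAt_exp_mul_ofReal (l m - l j) s x).const_mul c).mul
    (hf x hx i)).congr_deriv ?_
  simp only [mulVec_smul, Pi.smul_apply, smul_eq_mul]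
  ring

/-- The cross product of two columns is a column of the adjugate system. -/
theorem SolvesOn.cross {j₀ j₁ j₂ : Fin 3} {f g : ℝ → Fin 3 → ℂ}
    (hl : l j₀ + l j₁ + l j₂ = l 0 + l 1 + l 2) (hP : ∀ x ∈ s, (P x).trace = 0)
    (hf : SolvesOn l P j₁ f s) (hg : SolvesOn l P j₂ g s) :
    SolvesOn (-l) (fun x => -(P x)ᵀ) j₀ (fun x => f x ⨯₃ g x) s := by
  intro x hx i
  -- The identity behind all three entries is Af × g + f × Ag = (tr A)(f × g) - Aᵀ(f × g). The trace
  -- of P vanishes, and `hl` turns the sum of the exponents of the two columns into that of index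
  -- j₀.
  have htr := hP x hx
  have hF := hf x hx
  have hG := hg x hx
  simp only [Matrix.trace_fin_three] at htr
  simp only [mulVec, dotProduct, Fin.sum_univ_three] at hF hG
  fin_cases i <;>
    simp only [cross_apply, Fin.zero_eta, Fin.mk_one, Fin.reduceFinMk, Matrix.cons_val,
      Pi.neg_apply, mulVec, dotProduct, Fin.sum_univ_three, Matrix.neg_apply, transpose_apply]
  · refine (((hF 1).mul (hG 2)).sub ((hF 2).mul (hG 1))).congr_deriv ?_
    linear_combination (f x 1 * g x 2 - f x 2 * g x 1) * (htr - hl)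
  · refine (((hF 2).mul (hG 0)).sub ((hF 0).mul (hG 2))).congr_deriv ?_
    linear_combination (f x 2 * g x 0 - f x 0 * g x 2) * (htr - hl)
  · refine (((hF 0).mul (hG 1)).sub ((hF 1).mul (hG 0))).congr_deriv ?_
    linear_combination (f x 0 * g x 1 - f x 1 * g x 0) * (htr - hl)

/-- The pairing of a column with a column of the adjugate system is constant up to an
exponential factor. -/
theorem SolvesOn.pairing_eq {j j' : Fin 3} {f g : ℝ → Fin 3 → ℂ} (hs : Convex ℝ s)
    (hf : SolvesOn l P j f s) (hg : SolvesOn (-l) (fun x => -(P x)ᵀ) j' g s)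
    {x y : ℝ} (hx : x ∈ s) (hy : y ∈ s) :
    (f x ⬝ᵥ g x) * exp ((l j - l j') * x) = (f y ⬝ᵥ g y) * exp ((l j - l j') * y) := by
  have h : ∀ x ∈ s, HasDerivWithinAt (fun x => (f x ⬝ᵥ g x) * exp ((l j - l j') * x)) 0 s x := by
    intro x hx
    have hF := hf x hx
    have hG := hg x hx
    simp only [mulVec, dotProduct, Fin.sum_univ_three, Pi.neg_apply, Matrix.neg_apply,
      transpose_apply] at hF hG ⊢
    refine (((((hF 0).mul (hG 0)).add ((hF 1).mul (hG 1))).add ((hF 2).mul (hG 2))).mul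
      (hasDerivWithinAt_exp_mul_ofReal (l j - l j') s x)).congr_deriv ?_
    simp only [Pi.add_apply, Pi.mul_apply]
    ring
  have := hs.norm_image_sub_le_of_norm_hasDerivWithin_le (C := 0) h (by simp) hy hx
  rw [zero_mul, norm_le_zero_iff, sub_eq_zero] at this
  exact this

end System

/-! ### Energy estimate on the half-line and integrals from infinity. -/

section Energy

variable {l : Fin 3 → ℂ} {P : ℝ → Matrix (Fin 3) (Fin 3) ℂ} {C : ℝ} {j : Fin 3}
  {f : ℝ → Fin 3 → ℂ}

theorem norm_mulVec_apply_le {B : Matrix (Fin 3) (Fin 3) ℂ} {p q : ℝ} (hB : ∀ i m, ‖B i m‖ ≤ p)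
    {w : Fin 3 → ℂ} (hw : ∀ m, ‖w m‖ ≤ q) (i : Fin 3) : ‖(B *ᵥ w) i‖ ≤ 3 * p * q := by
  have hp : 0 ≤ p := (norm_nonneg _).trans (hB 0 0)
  have h : ∀ m, ‖B i m * w m‖ ≤ p * q := fun m => by
    rw [norm_mul]
    exact mul_le_mul (hB i m) (hw m) (norm_nonneg _) hp
  simp only [mulVec, dotProduct, Fin.sum_univ_three]
  have := norm_add₃_le (a := B i 0 * w 0) (b := B i 1 * w 1) (c := B i 2 * w 2)
  linarith [h 0, h 1, h 2]

/-- Growing columns of a system with integrable coefficients do not decrease much. -/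
theorem SolvesOn.energy_mono (hf : SolvesOn l P j f (Ici 0))
    (hl : ∀ i, (l j).re ≤ (l i).re) (hP : ∀ x, 0 ≤ x → ∀ i m, ‖P x i m‖ ≤ C / (1 + x) ^ 2) :
    MonotoneOn (fun x : ℝ => (∑ i, ‖f x i‖ ^ 2) * Real.exp (-(6 * C) / (1 + x))) (Ici 0) := by
  -- With p = C / (1 + x)², the energy E satisfies E' ≥ -6pE, since the diagonal part contributes
  -- nonnegatively. The weight exp(-6C / (1 + x)) is the integrating factor for 6p.
  have hd : ∀ x ∈ Ici (0 : ℝ), HasDerivWithinAt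
      (fun x : ℝ => (∑ i, ‖f x i‖ ^ 2) * Real.exp (-(6 * C) / (1 + x)))
      ((∑ i, 2 * inner ℝ (f x i) ((l i - l j) * f x i + (P x *ᵥ f x) i)) *
          Real.exp (-(6 * C) / (1 + x)) +
        (∑ i, ‖f x i‖ ^ 2) * (Real.exp (-(6 * C) / (1 + x)) * (6 * C / (1 + x) ^ 2)))
      (Ici 0) x := by
    intro x hx
    have hx1 : 1 + x ≠ 0 := by linarith [mem_Ici.1 hx]
    have h1 : HasDerivAt (fun x : ℝ => -(6 * C) / (1 + x)) (6 * C / (1 + x) ^ 2) x := by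
      refine (((hasDerivAt_id x).const_add 1).inv hx1 |>.const_mul (-(6 * C))).congr_deriv ?_
      simp only [id]
      ring
    refine HasDerivWithinAt.mul ?_ h1.exp.hasDerivWithinAt
    exact HasDerivWithinAt.fun_sum fun i _ => (hf x hx i).norm_sq
  refine monotoneOn_of_hasDerivWithinAt_nonneg (convex_Ici 0)
    (fun x hx => (hd x hx).continuousWithinAt)
    (fun x hx => (hd x (interior_subset hx)).mono interior_subset) ?_
  intro x hx
  have hx0 : 0 ≤ x := mem_Ici.1 (interior_subset hx)
  set p : ℝ := C / (1 + x) ^ 2 with hp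
  have hp0 : 0 ≤ p := (norm_nonneg _).trans (hP x hx0 0 0)
  have hin : ∀ i, -(‖f x i‖ * (p * (‖f x 0‖ + ‖f x 1‖ + ‖f x 2‖))) ≤
      inner ℝ (f x i) ((l i - l j) * f x i + (P x *ᵥ f x) i) := by
    intro i
    rw [inner_add_right]
    have h1 : 0 ≤ inner ℝ (f x i) ((l i - l j) * f x i) := by
      have : inner ℝ (f x i) ((l i - l j) * f x i) =
          ((l i).re - (l j).re) * normSq (f x i) := by
        simp only [Complex.inner, normSq_apply, mul_re, mul_im, conj_re, conj_im, sub_re, sub_im]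
        ring
      rw [this]
      exact mul_nonneg (sub_nonneg.2 (hl i)) (normSq_nonneg _)
    have h2 : ‖(P x *ᵥ f x) i‖ ≤ p * (‖f x 0‖ + ‖f x 1‖ + ‖f x 2‖) := by
      simp only [mulVec, dotProduct, Fin.sum_univ_three]
      have h3 := norm_add₃_le (a := P x i 0 * f x 0) (b := P x i 1 * f x 1) (c := P x i 2 * f x 2)
      have h4 : ∀ m, ‖P x i m * f x m‖ ≤ p * ‖f x m‖ := fun m => by
        rw [norm_mul]
        gcongr
        exact hP x hx0 i m
      linarith [h4 0, h4 1, h4 2]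
    have h3 := abs_real_inner_le_norm (f x i) ((P x *ᵥ f x) i)
    have h4 := (abs_le.1 h3).1
    have h5 : ‖f x i‖ * ‖(P x *ᵥ f x) i‖ ≤ ‖f x i‖ * (p * (‖f x 0‖ + ‖f x 1‖ + ‖f x 2‖)) := by
      gcongr
    linarith
  have hE : 0 < Real.exp (-(6 * C) / (1 + x)) := Real.exp_pos _
  have h6 : 6 * C / (1 + x) ^ 2 = 6 * p := by rw [hp]; ring
  rw [h6]
  have hmain : 0 ≤ (∑ i, 2 * inner ℝ (f x i) ((l i - l j) * f x i + (P x *ᵥ f x) i)) +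
      (∑ i, ‖f x i‖ ^ 2) * (6 * p) := by
    simp only [Fin.sum_univ_three]
    -- The sum of squared differences is 3∑aᵢ² - (∑aᵢ)². This Cauchy–Schwarz defect is the source of
    -- the constant 6 = 2 · 3.
    have hq : 0 ≤ p * ((‖f x 0‖ - ‖f x 1‖) ^ 2 + (‖f x 0‖ - ‖f x 2‖) ^ 2 +
      (‖f x 1‖ - ‖f x 2‖) ^ 2) := by positivity
    nlinarith [hin 0, hin 1, hin 2]
  calc (0 : ℝ) ≤ ((∑ i, 2 * inner ℝ (f x i) ((l i - l j) * f x i + (P x *ᵥ f x) i)) +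
      (∑ i, ‖f x i‖ ^ 2) * (6 * p)) * Real.exp (-(6 * C) / (1 + x)) := mul_nonneg hmain hE.le
    _ = _ := by ring

/-- The weight in the monotone quantity lies between e^{-6C} and 1. Smallness at a far point is
thereby carried back towards the origin at a cost independent of the exponents. -/
theorem SolvesOn.energy_le (hf : SolvesOn l P j f (Ici 0))
    (hl : ∀ i, (l j).re ≤ (l i).re) (hP : ∀ x, 0 ≤ x → ∀ i m, ‖P x i m‖ ≤ C / (1 + x) ^ 2)
    {x y : ℝ} (hx : 0 ≤ x) (hxy : x ≤ y) :
    ∑ i, ‖f x i‖ ^ 2 ≤ Real.exp (6 * C) * ∑ i, ‖f y i‖ ^ 2 := by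
  have hC : 0 ≤ C := by simpa using (norm_nonneg _).trans (hP 0 le_rfl 0 0)
  have hy : 0 ≤ y := hx.trans hxy
  have h := hf.energy_mono hl hP (mem_Ici.2 hx) (mem_Ici.2 hy) hxy
  simp only at h
  have h1 : Real.exp (-(6 * C)) ≤ Real.exp (-(6 * C) / (1 + x)) := by
    gcongr
    rw [neg_div]
    exact neg_le_neg (div_le_self (by positivity) (by linarith))
  have h2 : Real.exp (-(6 * C) / (1 + y)) ≤ 1 := by
    rw [Real.exp_le_one_iff, neg_div]
    exact neg_nonpos.2 (by positivity)
  have h3 : (∑ i, ‖f x i‖ ^ 2) * Real.exp (-(6 * C)) ≤ ∑ i, ‖f y i‖ ^ 2 := by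
    refine (mul_le_mul_of_nonneg_left h1 (by positivity)).trans (h.trans ?_)
    exact mul_le_of_le_one_right (by positivity) h2
  calc ∑ i, ‖f x i‖ ^ 2 =
      Real.exp (6 * C) * ((∑ i, ‖f x i‖ ^ 2) * Real.exp (-(6 * C))) := by
        rw [mul_left_comm, ← Real.exp_add, add_neg_cancel, Real.exp_zero, mul_one]
    _ ≤ _ := by gcongr

/-- A growing column that vanishes at infinity is zero. -/
theorem SolvesOn.eq_zero_of_tendsto (hf : SolvesOn l P j f (Ici 0))
    (hl : ∀ i, (l j).re ≤ (l i).re) (hP : ∀ x, 0 ≤ x → ∀ i m, ‖P x i m‖ ≤ C / (1 + x) ^ 2)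
    (hlim : ∀ i, Tendsto (fun x => f x i) atTop (𝓝 0)) {x : ℝ} (hx : 0 ≤ x) : f x = 0 := by
  have h1 : Tendsto (fun y => Real.exp (6 * C) * ∑ i, ‖f y i‖ ^ 2) atTop (𝓝 0) := by
    simpa using (tendsto_finsetSum Finset.univ
      (fun i _ => ((hlim i).norm.pow 2))).const_mul (Real.exp (6 * C))
  have h2 : ∑ i, ‖f x i‖ ^ 2 ≤ 0 := ge_of_tendsto h1 <| by
    filter_upwards [eventually_ge_atTop x] with y hy
    exact hf.energy_le hl hP hx hy
  have h3 := (Finset.sum_eq_zero_iff_of_nonneg (fun i _ => by positivity)).1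
    (le_antisymm h2 (by positivity))
  ext i
  simpa using h3 i (Finset.mem_univ i)

theorem integral_Ioi_inv_sq {x : ℝ} (hx : 0 ≤ x) (c : ℝ) :
    IntegrableOn (fun ξ : ℝ => c / (1 + ξ) ^ 2) (Ioi x) ∧
      ∫ ξ in Ioi x, c / (1 + ξ) ^ 2 = c / (1 + x) := by
  have hd : ∀ ξ ∈ Ici x, HasDerivAt (fun ξ : ℝ => -(1 + ξ)⁻¹) (1 / (1 + ξ) ^ 2) ξ := by
    intro ξ hξ
    have h1 : 1 + ξ ≠ 0 := by linarith [mem_Ici.1 hξ]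
    refine (((hasDerivAt_id ξ).const_add 1).inv h1).neg.congr_deriv ?_
    simp only [id]
    ring
  have hlim : Tendsto (fun ξ : ℝ => -(1 + ξ)⁻¹) atTop (𝓝 0) := by
    simpa using (tendsto_inv_atTop_zero.comp (tendsto_atTop_add_const_left _ (1 : ℝ) tendsto_id)).neg
  have hint := integrableOn_Ioi_deriv_of_nonneg' hd (fun ξ _ => by positivity) hlim
  have hval := integral_Ioi_of_hasDerivAt_of_nonneg' hd (fun ξ _ => by positivity) hlim
  have heq : (fun ξ : ℝ => c / (1 + ξ) ^ 2) = fun ξ => c * (1 / (1 + ξ) ^ 2) := by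
    ext ξ
    ring
  rw [heq]
  refine ⟨hint.const_mul c, ?_⟩
  rw [integral_const_mul, hval]
  ring

/-- The rate at which an integral from infinity vanishes. -/
theorem norm_integral_Ioi_exp_mul_le {B x : ℝ} {g : ℝ → Fin 3 → ℂ} {c : ℂ} (hx : 0 ≤ x)
    (hc : 0 ≤ c.re) (hP : ∀ x, 0 ≤ x → ∀ i m, ‖P x i m‖ ≤ C / (1 + x) ^ 2)
    (hg : ∀ x, 0 ≤ x → ∀ m, ‖g x m‖ ≤ B) (i : Fin 3) :
    ‖∫ ξ in Ioi x, exp (c * ((x : ℂ) - (ξ : ℂ))) * (P ξ *ᵥ g ξ) i‖ ≤ 3 * C * B / (1 + x) := by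
  obtain ⟨h1, h2⟩ := integral_Ioi_inv_sq hx (3 * C * B)
  rw [← h2]
  refine norm_integral_le_of_norm_le h1 ?_
  refine (ae_restrict_iff' measurableSet_Ioi).2 (ae_of_all _ fun ξ hξ => ?_)
  have hξ0 : 0 ≤ ξ := hx.trans (mem_Ioi.1 hξ).le
  have h3 := norm_mulVec_apply_le (hP ξ hξ0) (hg ξ hξ0) i
  have h4 : ‖exp (c * ((x : ℂ) - (ξ : ℂ)))‖ ≤ 1 := by
    rw [norm_exp, Real.exp_le_one_iff, ← ofReal_sub, re_mul_ofReal]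
    exact mul_nonpos_of_nonneg_of_nonpos hc (by linarith [mem_Ioi.1 hξ])
  rw [norm_mul]
  calc _ ≤ 1 * (3 * (C / (1 + ξ) ^ 2) * B) := by gcongr
    _ = 3 * C * B / (1 + ξ) ^ 2 := by ring

end Energy

/-! ### Cofactors -/

theorem cofactor_eq_transpose_adjugate (B : Matrix (Fin 3) (Fin 3) ℂ) :
    cofactor B = (adjugate B)ᵀ := by
  ext i j
  rw [transpose_apply, adjugate_fin_succ_eq_det_submatrix]
  rfl

theorem mul_transpose_cofactor (B : Matrix (Fin 3) (Fin 3) ℂ) :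
    B * (cofactor B)ᵀ = B.det • (1 : Matrix (Fin 3) (Fin 3) ℂ) := by
  rw [cofactor_eq_transpose_adjugate, transpose_transpose, mul_adjugate]

theorem cofactor_mul_transpose (B : Matrix (Fin 3) (Fin 3) ℂ) :
    cofactor B * Bᵀ = B.det • (1 : Matrix (Fin 3) (Fin 3) ℂ) := by
  have := congrArg transpose (mul_transpose_cofactor B)
  simpa using this

/-- The columns of the cofactor matrix are cross products of columns. -/
theorem cofactor_col (B : Matrix (Fin 3) (Fin 3) ℂ) :
    (cofactor B).col 0 = B.col 1 ⨯₃ B.col 2 ∧ (cofactor B).col 1 = B.col 2 ⨯₃ B.col 0 ∧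
      (cofactor B).col 2 = B.col 0 ⨯₃ B.col 1 := by
  refine ⟨?_, ?_, ?_⟩ <;> ext i <;> fin_cases i <;>
    simp [cofactor_eq_transpose_adjugate, adjugate_fin_three, cross_apply, Matrix.col] <;> ring

theorem det_eq_dotProduct_cross (B : Matrix (Fin 3) (Fin 3) ℂ) :
    B.det = B.col 0 ⬝ᵥ B.col 1 ⨯₃ B.col 2 := by
  rw [det_fin_three]
  simp only [cross_apply, dotProduct, Fin.sum_univ_three, Matrix.cons_val, Matrix.col,
    Matrix.transpose_apply]
  ring

/-! ### Solutions on the half-strip -/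

/-- `f` solves the first equation of the Lax pair on the half-strip and the second one on the
boundary `x = 0`. -/
structure IsStripSolution (T : ℝ) (l z : Fin 3 → ℂ) (P Q : ℝ → ℝ → Matrix (Fin 3) (Fin 3) ℂ)
    (j : Fin 3) (f : ℝ → ℝ → Fin 3 → ℂ) : Prop where
  solves_x : ∀ t ∈ Icc 0 T, SolvesOn l (fun x => P x t) j (fun x => f x t) (Ici 0)
  solves_t : SolvesOn z (fun t => Q 0 t) j (fun t => f 0 t) (Icc 0 T)

section Strip

variable {T : ℝ} {l z : Fin 3 → ℂ} {P Q : ℝ → ℝ → Matrix (Fin 3) (Fin 3) ℂ}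

theorem IsEigencolumn.isStripSolution {c : Fin 3 → Contour} {j : Fin 3} {f : ℝ → ℝ → Fin 3 → ℂ}
    (h : IsEigencolumn T l z P Q c j f) : IsStripSolution T l z P Q j f where
  solves_x t ht x hx i := h.lax_x x t hx ht i
  solves_t t ht i := h.lax_t 0 t le_rfl ht i

theorem IsStripSolution.cross {j₀ j₁ j₂ : Fin 3} {f g : ℝ → ℝ → Fin 3 → ℂ}
    (hl : l j₀ + l j₁ + l j₂ = l 0 + l 1 + l 2) (hz : z j₀ + z j₁ + z j₂ = z 0 + z 1 + z 2)
    (hP : ∀ x t, (P x t).trace = 0) (hQ : ∀ x t, (Q x t).trace = 0)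
    (hf : IsStripSolution T l z P Q j₁ f) (hg : IsStripSolution T l z P Q j₂ g) :
    IsStripSolution T (-l) (-z) (fun x t => -(P x t)ᵀ) (fun x t => -(Q x t)ᵀ) j₀
      (fun x t => f x t ⨯₃ g x t) where
  solves_x t ht := (hf.solves_x t ht).cross hl (fun x _ => hP x t) (hg.solves_x t ht)
  solves_t := hf.solves_t.cross hz (fun t _ => hQ 0 t) hg.solves_t

/-- The pairing with a solution of the adjugate system is constant up to an exponential. -/
theorem IsStripSolution.pairing_eq {j j' : Fin 3} {f g : ℝ → ℝ → Fin 3 → ℂ}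
    (hf : IsStripSolution T l z P Q j f)
    (hg : IsStripSolution T (-l) (-z) (fun x t => -(P x t)ᵀ) (fun x t => -(Q x t)ᵀ) j' g)
    {x t τ : ℝ} (hx : 0 ≤ x) (ht : t ∈ Icc 0 T) (hτ : τ ∈ Icc 0 T) :
    (f x t ⬝ᵥ g x t) * exp ((l j - l j') * x + (z j - z j') * t) =
      (f 0 τ ⬝ᵥ g 0 τ) * exp ((z j - z j') * τ) := by
  have h1 := (hf.solves_x t ht).pairing_eq (convex_Ici 0) (hg.solves_x t ht) hx (mem_Ici.2 le_rfl)
  have h2 := hf.solves_t.pairing_eq (convex_Icc 0 T) hg.solves_t ht hτ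
  simp only [ofReal_zero, mul_zero, exp_zero, mul_one] at h1
  rw [exp_add, ← mul_assoc, h1, h2]

variable {Φ : ℝ → ℝ → Matrix (Fin 3) (Fin 3) ℂ}

/-- The cofactor matrix of a solution solves the adjugate system. -/
theorem isStripSolution_cofactor (hP : ∀ x t, (P x t).trace = 0) (hQ : ∀ x t, (Q x t).trace = 0)
    (hΦ : ∀ j, IsStripSolution T l z P Q j (fun x t => (Φ x t).col j)) (j : Fin 3) :
    IsStripSolution T (-l) (-z) (fun x t => -(P x t)ᵀ) (fun x t => -(Q x t)ᵀ) j
      (fun x t => (cofactor (Φ x t)).col j) := by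
  fin_cases j
  · simp only [Fin.zero_eta, (cofactor_col _).1]
    exact (hΦ 1).cross (by ring) (by ring) hP hQ (hΦ 2)
  · simp only [Fin.mk_one, (cofactor_col _).2.1]
    exact (hΦ 2).cross (by ring) (by ring) hP hQ (hΦ 0)
  · simp only [Fin.reduceFinMk, (cofactor_col _).2.2]
    exact (hΦ 0).cross (by ring) (by ring) hP hQ (hΦ 1)

/-- The determinant of a solution is constant. -/
theorem det_eq_one (hP : ∀ x t, (P x t).trace = 0) (hQ : ∀ x t, (Q x t).trace = 0)
    (hΦ : ∀ j, IsStripSolution T l z P Q j (fun x t => (Φ x t).col j)) {τ : ℝ} (hτ : τ ∈ Icc 0 T)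
    (h0 : Φ 0 τ = 1) {x t : ℝ} (hx : 0 ≤ x) (ht : t ∈ Icc 0 T) : (Φ x t).det = 1 := by
  have h := (hΦ 0).pairing_eq (isStripSolution_cofactor hP hQ hΦ 0) hx ht hτ
  simp only [(cofactor_col _).1, ← det_eq_dotProduct_cross, sub_self, zero_mul, add_zero,
    exp_zero, mul_one, h0, det_one] at h
  exact h

/-- Every solution is obtained from its value at the origin by means of a fundamental one. -/
theorem IsStripSolution.eq_mulVec (hP : ∀ x t, (P x t).trace = 0)
    (hQ : ∀ x t, (Q x t).trace = 0)
    (hΦ : ∀ j, IsStripSolution T l z P Q j (fun x t => (Φ x t).col j)) {τ : ℝ} (hτ : τ ∈ Icc 0 T)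
    (h0 : Φ 0 τ = 1) {j : Fin 3} {f : ℝ → ℝ → Fin 3 → ℂ} (hf : IsStripSolution T l z P Q j f)
    {x t : ℝ} (hx : 0 ≤ x) (ht : t ∈ Icc 0 T) :
    f x t = (Φ x t * diagonal (fun m => exp ((l m - l j) * x + (z m - z j) * t)) *
      (cofactor (Φ 0 0))ᵀ) *ᵥ f 0 0 := by
  have hT : (0 : ℝ) ∈ Icc 0 T := ⟨le_rfl, ht.1.trans ht.2⟩
  -- Row m is the pairing of f with the m-th cofactor column, which is known up to its exponential.
  -- Multiplication by Φ then recovers f, since Φ times its transposed cofactor matrix is det Φ = 1.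
  have hpair : (cofactor (Φ x t))ᵀ *ᵥ f x t =
      diagonal (fun m => exp ((l m - l j) * x + (z m - z j) * t)) *ᵥ
        ((cofactor (Φ 0 0))ᵀ *ᵥ f 0 0) := by
    ext m
    have h := hf.pairing_eq (isStripSolution_cofactor hP hQ hΦ m) hx ht hT
    simp only [ofReal_zero, mul_zero, exp_zero, mul_one] at h
    rw [mulVec_diagonal]
    have h1 : ∀ y s, ((cofactor (Φ y s))ᵀ *ᵥ f y s) m = f y s ⬝ᵥ (cofactor (Φ y s)).col m :=
      fun y s => dotProduct_comm _ _
    rw [h1, h1, ← h, mul_left_comm, ← exp_add]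
    have h2 : (l m - l j) * (x : ℂ) + (z m - z j) * t +
      ((l j - l m) * x + (z j - z m) * t) = 0 := by ring
    rw [h2, exp_zero, mul_one]
  have hdet := det_eq_one hP hQ hΦ hτ h0 hx ht
  rw [← mulVec_mulVec, ← mulVec_mulVec, ← hpair, mulVec_mulVec, mul_transpose_cofactor, hdet,
    one_smul, one_mulVec]

end Strip

/-! ### Holomorphic dependence of the columns on the spectral parameter -/

theorem SolvesOn.mono {l : Fin 3 → ℂ} {P : ℝ → Matrix (Fin 3) (Fin 3) ℂ} {s s' : Set ℝ}
    {j : Fin 3} {f : ℝ → Fin 3 → ℂ} (hf : SolvesOn l P j f s) (h : s' ⊆ s) :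
    SolvesOn l P j f s' := fun x hx i => (hf x (h hx) i).mono h

/-- The parameter enters the whole system matrix, diagonal part included, only through entire scalar
factors in front of bounded matrices that do not depend on it. -/
theorem differentiable_of_solvesOn {ι : Type*} [Fintype ι] {a b K : ℝ} (hab : a ≤ b)
    {c : ι → ℂ → ℂ} (hc : ∀ n, Differentiable ℂ (c n))
    {B : ι → ℝ → Matrix (Fin 3) (Fin 3) ℂ} (hB : ∀ n, ∀ x ∈ Icc a b, ∀ i m, ‖B n x i m‖ ≤ K)
    {l : ℂ → Fin 3 → ℂ} {P : ℂ → ℝ → Matrix (Fin 3) (Fin 3) ℂ} {j : Fin 3}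
    (hdec : ∀ w, ∀ x ∈ Icc a b, diagonal (fun i => l w i - l w j) + P w x = ∑ n, c n w • B n x)
    {f : ℂ → ℝ → Fin 3 → ℂ} (hf : ∀ w, SolvesOn (l w) (P w) j (f w) (Icc a b))
    (h0 : Differentiable ℂ (fun w => f w a)) : Differentiable ℂ (fun w => f w b) := by
  refine differentiable_of_linear_ode_sum hab (K := 3 * |K|) hc
    (B := fun n x => (toLin' (B n x)).toContinuousLinearMap) (fun n x hx => ?_)
    (fun w x hx => ?_) h0
  · refine ContinuousLinearMap.opNorm_le_bound _ (by positivity) fun y => ?_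
    refine (pi_norm_le_iff_of_nonneg (by positivity)).2 fun i => ?_
    exact norm_mulVec_apply_le (fun i m => (hB n x hx i m).trans (le_abs_self K))
      (norm_le_pi_norm y) i
  · refine hasDerivWithinAt_pi.2 fun i => (hf w x hx i).congr_deriv ?_
    have h := congrArg (fun A => (A *ᵥ f w x) i) (hdec w x hx)
    simp only [add_mulVec, Pi.add_apply, mulVec_diagonal, sum_mulVec, smul_mulVec,
      Finset.sum_apply] at h
    rw [h]
    simp

theorem SolvesOn.reverse {l : Fin 3 → ℂ} {P : ℝ → Matrix (Fin 3) (Fin 3) ℂ} {a b : ℝ}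
    {j : Fin 3} {f : ℝ → Fin 3 → ℂ} (hf : SolvesOn l P j f (Icc a b)) :
    SolvesOn (-l) (fun x => -P (a + b - x)) j (fun x => f (a + b - x)) (Icc a b) := by
  intro x hx i
  have hmaps : MapsTo (fun x => a + b - x) (Icc a b) (Icc a b) := fun y hy =>
    ⟨by linarith [hy.2], by linarith [hy.1]⟩
  have h := (hf (a + b - x) (hmaps hx) i).scomp x
    ((hasDerivAt_id x).const_sub (a + b)).hasDerivWithinAt hmaps
  refine h.congr_deriv ?_
  simp only [neg_mulVec, Pi.neg_apply, neg_smul, one_smul]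
  ring

/-- Reflecting the interval reverses the direction of integration. This is needed for `μ₁`, whose
initial value sits at the right end point t = T. -/
theorem differentiable_of_solvesOn_reverse {ι : Type*} [Fintype ι] {a b K : ℝ} (hab : a ≤ b)
    {c : ι → ℂ → ℂ} (hc : ∀ n, Differentiable ℂ (c n))
    {B : ι → ℝ → Matrix (Fin 3) (Fin 3) ℂ} (hB : ∀ n, ∀ x ∈ Icc a b, ∀ i m, ‖B n x i m‖ ≤ K)
    {l : ℂ → Fin 3 → ℂ} {P : ℂ → ℝ → Matrix (Fin 3) (Fin 3) ℂ} {j : Fin 3}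
    (hdec : ∀ w, ∀ x ∈ Icc a b, diagonal (fun i => l w i - l w j) + P w x = ∑ n, c n w • B n x)
    {f : ℂ → ℝ → Fin 3 → ℂ} (hf : ∀ w, SolvesOn (l w) (P w) j (f w) (Icc a b))
    (h0 : Differentiable ℂ (fun w => f w b)) : Differentiable ℂ (fun w => f w a) := by
  have hmaps : ∀ x ∈ Icc a b, a + b - x ∈ Icc a b := fun y hy =>
    ⟨by linarith [hy.2], by linarith [hy.1]⟩
  have := differentiable_of_solvesOn hab hc (B := fun n x => -B n (a + b - x)) (K := K)
    (fun n x hx i m => by simpa using hB n _ (hmaps x hx) i m)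
    (l := fun w => -l w) (P := fun w x => -P w (a + b - x)) (j := j)
    (fun w x hx => by
      have h := congrArg Neg.neg (hdec w _ (hmaps x hx))
      simp only [smul_neg, Finset.sum_neg_distrib, ← h, neg_add, diagonal_neg]
      congr 2
      ext i
      simp
      ring)
    (fun w => (hf w).reverse) (by simpa using h0)
  simpa using this

/-! ### Columns normalized at infinity -/

/-- `f` is a bounded solution on the half-line with the index `j` of a growing exponential,
normalized at infinity. -/
structure IsJostColumn (l : Fin 3 → ℂ) (P : ℝ → Matrix (Fin 3) (Fin 3) ℂ) (C : ℝ) (j : Fin 3)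
    (f : ℝ → Fin 3 → ℂ) : Prop where
  solves : SolvesOn l P j f (Ici 0)
  re_le : ∀ i, (l j).re ≤ (l i).re
  norm_coeff_le : ∀ x, 0 ≤ x → ∀ i m, ‖P x i m‖ ≤ C / (1 + x) ^ 2
  integral_eq : ∀ x, 0 ≤ x → ∀ i, f x i = (if i = j then 1 else 0) +
    -∫ ξ in Ioi x, exp ((l i - l j) * ((x : ℂ) - (ξ : ℂ))) * (P ξ *ᵥ f ξ) i
  bounded : ∃ B, ∀ x, 0 ≤ x → ∀ i, ‖f x i‖ ≤ B

theorem tendsto_const_div_one_add (c : ℝ) : Tendsto (fun x : ℝ => c / (1 + x)) atTop (𝓝 0) :=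
  tendsto_const_nhds.div_atTop (tendsto_atTop_add_const_left _ (1 : ℝ) tendsto_id)

/-- The integral from infinity is O(1 / (1 + x)) when Re l_j ≤ Re l_i. Only row i has to satisfy
this integral equation, so the result also serves columns of M that have another contour in another
row. -/
theorem tendsto_of_integral_eq {l : Fin 3 → ℂ} {P : ℝ → Matrix (Fin 3) (Fin 3) ℂ} {B C : ℝ}
    {i j : Fin 3} {f : ℝ → Fin 3 → ℂ} (hl : (l j).re ≤ (l i).re)
    (hP : ∀ x, 0 ≤ x → ∀ i m, ‖P x i m‖ ≤ C / (1 + x) ^ 2) (hB : ∀ x, 0 ≤ x → ∀ i, ‖f x i‖ ≤ B)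
    (hf : ∀ x, 0 ≤ x → f x i = (if i = j then 1 else 0) +
      -∫ ξ in Ioi x, exp ((l i - l j) * ((x : ℂ) - (ξ : ℂ))) * (P ξ *ᵥ f ξ) i) :
    Tendsto (fun x => f x i) atTop (𝓝 (if i = j then 1 else 0)) := by
  rw [tendsto_iff_norm_sub_tendsto_zero]
  refine squeeze_zero' (Eventually.of_forall fun x => norm_nonneg _) ?_
    (tendsto_const_div_one_add (3 * C * B))
  filter_upwards [eventually_ge_atTop 0] with x hx
  rw [hf x hx, add_sub_cancel_left, norm_neg]
  exact norm_integral_Ioi_exp_mul_le hx (by simpa using hl) hP hB i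

namespace IsJostColumn

variable {l : Fin 3 → ℂ} {P : ℝ → Matrix (Fin 3) (Fin 3) ℂ} {C : ℝ} {j : Fin 3}
  {f : ℝ → Fin 3 → ℂ}

theorem tendsto (h : IsJostColumn l P C j f) (i : Fin 3) :
    Tendsto (fun x => f x i) atTop (𝓝 (if i = j then 1 else 0)) := by
  obtain ⟨B, hB⟩ := h.bounded
  exact tendsto_of_integral_eq (h.re_le i) h.norm_coeff_le hB fun x hx => h.integral_eq x hx i

/-- The energy tends to 1 at infinity, so it is at most e^{6C} everywhere. The unspecified bound is
thus replaced by one depending on C alone, which makes the later estimates locally uniform in the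
spectral parameter. -/
theorem norm_le (h : IsJostColumn l P C j f) {x : ℝ} (hx : 0 ≤ x) (i : Fin 3) :
    ‖f x i‖ ≤ Real.exp (6 * C) := by
  have hC : 0 ≤ C := by simpa using (norm_nonneg _).trans (h.norm_coeff_le 0 le_rfl 0 0)
  have h1 : Tendsto (fun y => Real.exp (6 * C) * ∑ i, ‖f y i‖ ^ 2) atTop
      (𝓝 (Real.exp (6 * C) * 1)) := by
    have h2 := (tendsto_finsetSum Finset.univ
      (fun i _ => ((h.tendsto i).norm.pow 2))).const_mul (Real.exp (6 * C))
    convert h2 using 3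
    rw [Finset.sum_eq_single j] <;> simp +contextual
  have h2 : ∑ i, ‖f x i‖ ^ 2 ≤ Real.exp (6 * C) * 1 := ge_of_tendsto h1 <| by
    filter_upwards [eventually_ge_atTop x] with y hy
    exact h.solves.energy_le h.re_le h.norm_coeff_le hx hy
  have h3 : ‖f x i‖ ^ 2 ≤ ∑ i, ‖f x i‖ ^ 2 :=
    Finset.single_le_sum (f := fun i => ‖f x i‖ ^ 2) (fun i _ => by positivity)
      (Finset.mem_univ i)
  have h4 : (1 : ℝ) ≤ Real.exp (6 * C) := Real.one_le_exp (by positivity)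
  refine le_of_sq_le_sq ?_ (by positivity)
  nlinarith

theorem norm_sub_le (h : IsJostColumn l P C j f) {x : ℝ} (hx : 0 ≤ x) (i : Fin 3) :
    ‖(if i = j then 1 else 0) - f x i‖ ≤ 3 * C * Real.exp (6 * C) / (1 + x) := by
  rw [h.integral_eq x hx i, sub_add_cancel_left, neg_neg]
  exact norm_integral_Ioi_exp_mul_le hx (by simpa using h.re_le i) h.norm_coeff_le
    (fun x hx i => h.norm_le hx i) i

/-- Columns normalized at infinity are unique. -/
theorem eq_of_tendsto (h : IsJostColumn l P C j f) {g : ℝ → Fin 3 → ℂ}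
    (hg : SolvesOn l P j g (Ici 0))
    (hlim : ∀ i, Tendsto (fun x => g x i) atTop (𝓝 (if i = j then 1 else 0)))
    {x : ℝ} (hx : 0 ≤ x) : g x = f x := by
  have := (hg.sub h.solves).eq_zero_of_tendsto h.re_le h.norm_coeff_le (fun i => by
    simpa using (hlim i).sub (h.tendsto i)) hx
  exact sub_eq_zero.1 this

end IsJostColumn

theorem SolvesOn.sum {l : Fin 3 → ℂ} {P : ℝ → Matrix (Fin 3) (Fin 3) ℂ} {s : Set ℝ} {j : Fin 3}
    {g : Fin 3 → ℝ → Fin 3 → ℂ} (hg : ∀ m, SolvesOn l P j (g m) s) :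
    SolvesOn l P j (fun x => ∑ m, g m x) s := by
  simp only [Fin.sum_univ_three]
  exact ((hg 0).add (hg 1)).add (hg 2)

/-- A fundamental solution can be used to prescribe the value of a column at a point. -/
theorem solvesOn_of_fundamental {l : Fin 3 → ℂ} {P : ℝ → Matrix (Fin 3) (Fin 3) ℂ} {s : Set ℝ}
    {Φ Γ : ℝ → Matrix (Fin 3) (Fin 3) ℂ} (hΦ : ∀ m, SolvesOn l P m (fun x => (Φ x).col m) s)
    (j : Fin 3) {y : ℝ} (hy : Φ y * (Γ y)ᵀ = 1) :
    SolvesOn l P j (fun x => ∑ m, (Γ y j m * exp (-((l m - l j) * y)) *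
      exp ((l m - l j) * x)) • (Φ x).col m) s ∧
    ∀ i, (∑ m, (Γ y j m * exp (-((l m - l j) * y)) *
      exp ((l m - l j) * y)) • (Φ y).col m) i = if i = j then 1 else 0 := by
  refine ⟨SolvesOn.sum fun m => (hΦ m).change_index j _, fun i => ?_⟩
  rw [← one_apply, ← hy, mul_apply, Finset.sum_apply]
  refine Finset.sum_congr rfl fun m _ => ?_
  rw [Pi.smul_apply, smul_eq_mul, mul_assoc (Γ y j m), ← exp_add, neg_add_cancel, exp_zero,
    mul_one, mul_comm]
  rfl

/-- The value at the origin of a column normalized at infinity is holomorphic in a parameter. -/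
theorem differentiableOn_jostColumn {Ω : Set ℂ} (hΩ : IsOpen Ω) {l : ℂ → Fin 3 → ℂ}
    {P : ℂ → ℝ → Matrix (Fin 3) (Fin 3) ℂ} {C : ℂ → ℝ} (hC : Continuous C)
    {Φ Γ : ℂ → ℝ → Matrix (Fin 3) (Fin 3) ℂ}
    (hΦ : ∀ w m, SolvesOn (l w) (P w) m (fun x => (Φ w x).col m) (Ici 0))
    (hΦΓ : ∀ w x, 0 ≤ x → Φ w x * (Γ w x)ᵀ = 1)
    (hl : ∀ i, Differentiable ℂ (fun w => l w i))
    (hΦ0 : ∀ i m, Differentiable ℂ (fun w => Φ w 0 i m))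
    (hΓ : ∀ x, 0 ≤ x → ∀ i m, Differentiable ℂ (fun w => Γ w x i m))
    {j : Fin 3} {f : ℂ → ℝ → Fin 3 → ℂ}
    (hf : ∀ w ∈ Ω, IsJostColumn (l w) (P w) (C w) j (f w)) (i : Fin 3) :
    DifferentiableOn ℂ (fun w => f w 0 i) Ω := by
  -- `F n w` is entry i at x = 0 of the solution whose value at x = n is the j-th unit vector. It is
  -- holomorphic in w, being built from the fundamental solution.
  set F : ℕ → ℂ → ℂ := fun n w => (∑ m, (Γ w n j m * exp (-((l w m - l w j) * (n : ℝ))) *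
      exp ((l w m - l w j) * (0 : ℝ))) • (Φ w 0).col m) i with hF
  -- Each of the three entries of the error at x = n is at most 3Ce^{6C} / (1 + n), and transport
  -- back to 0 costs a factor e^{6C} in the energy. Continuity of H makes the convergence locally
  -- uniform.
  set H : ℂ → ℝ := fun w => Real.exp (6 * C w) * (3 * (3 * C w * Real.exp (6 * C w)) ^ 2) with hH
  have hHc : Continuous H := by fun_prop
  have hest : ∀ w ∈ Ω, ∀ n : ℕ, ‖f w 0 i - F n w‖ ^ 2 ≤ H w / (1 + n) ^ 2 := by
    intro w hw n
    have hn : (0 : ℝ) ≤ n := n.cast_nonneg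
    obtain ⟨h1, h2⟩ := solvesOn_of_fundamental (hΦ w) j (hΦΓ w n hn)
    have h3 := (h1.sub (hf w hw).solves).energy_le (hf w hw).re_le (hf w hw).norm_coeff_le
      le_rfl hn
    have h4 := Finset.single_le_sum (s := Finset.univ) (f := fun i => ‖((∑ m, (Γ w n j m *
      exp (-((l w m - l w j) * (n : ℝ))) * exp ((l w m - l w j) * (0 : ℝ))) • (Φ w 0).col m) -
        f w 0) i‖ ^ 2) (fun i _ => by positivity) (Finset.mem_univ i)
    have h5 : ∀ i, ‖((∑ m, (Γ w n j m * exp (-((l w m - l w j) * (n : ℝ))) *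
        exp ((l w m - l w j) * (n : ℝ))) • (Φ w n).col m) - f w n) i‖ ≤
        3 * C w * Real.exp (6 * C w) / (1 + n) := by
      intro i
      rw [Pi.sub_apply, h2 i]
      exact (hf w hw).norm_sub_le hn i
    rw [norm_sub_rev]
    refine h4.trans (h3.trans ?_)
    calc _ ≤ Real.exp (6 * C w) *
          ∑ _i : Fin 3, (3 * C w * Real.exp (6 * C w) / (1 + n)) ^ 2 := by
          gcongr with i
          exact h5 i
      _ = H w / (1 + n) ^ 2 := by
          rw [Finset.sum_const, Finset.card_univ, Fintype.card_fin, hH]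
          simp only [nsmul_eq_mul, div_pow]
          push_cast
          ring
  have hdiff : ∀ n, Differentiable ℂ (F n) := by
    intro n
    simp only [hF, Finset.sum_apply, Pi.smul_apply, smul_eq_mul, Matrix.col_apply]
    refine Differentiable.fun_sum fun m _ => ?_
    have := hΓ n n.cast_nonneg j m
    have h1 := hl m
    have h2 := hl j
    have h3 := hΦ0 i m
    fun_prop
  refine TendstoLocallyUniformlyOn.differentiableOn (F := F) (φ := atTop) ?_
    (Eventually.of_forall fun n => (hdiff n).differentiableOn) hΩ
  rw [Metric.tendstoLocallyUniformlyOn_iff]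
  intro ε hε w₀ _
  refine ⟨Ω ∩ {w | H w < H w₀ + 1}, inter_mem self_mem_nhdsWithin (mem_nhdsWithin_of_mem_nhds
    ((isOpen_lt hHc continuous_const).mem_nhds (by simp))), ?_⟩
  have hlim : Tendsto (fun n : ℕ => (H w₀ + 1) / (1 + (n : ℝ)) ^ 2) atTop (𝓝 0) := by
    refine Tendsto.div_atTop tendsto_const_nhds ?_
    exact (tendsto_pow_atTop two_ne_zero).comp
      (tendsto_atTop_add_const_left _ (1 : ℝ) tendsto_natCast_atTop_atTop)
  filter_upwards [hlim.eventually_lt_const (pow_pos hε 2)] with n hn w hw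
  rw [dist_eq_norm]
  refine lt_of_pow_lt_pow_left₀ 2 hε.le (lt_of_le_of_lt (hest w hw.1 n) (lt_of_le_of_lt ?_ hn))
  gcongr
  exact (show H w < H w₀ + 1 from hw.2).le

/-! ### Residues -/

/-- Here f = h / φ near a simple zero of φ, so the residue is h(w) / φ'(w). A vanishing h(w) is
allowed and gives residue 0. -/
theorem hasSimpleResidue_of_smul_eq {f h : ℂ → Fin 3 → ℂ} {φ : ℂ → ℂ} {w : ℂ}
    (hh : AnalyticAt ℂ h w) (hφ : AnalyticAt ℂ φ w) (h0 : φ w = 0) (h1 : deriv φ w ≠ 0)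
    (heq : ∀ᶠ ζ in 𝓝[≠] w, φ ζ • f ζ = h ζ) :
    HasSimpleResidue f w ((deriv φ w)⁻¹ • h w) := by
  have hslope := hasDerivAt_iff_tendsto_slope.1 hφ.differentiableAt.hasDerivAt
  have hne : ∀ᶠ ζ in 𝓝[≠] w, slope φ w ζ ≠ 0 := hslope.eventually_ne h1
  constructor
  · refine (hφ.meromorphicAt.inv.smul hh.meromorphicAt).congr ?_
    filter_upwards [heq, hne] with ζ h2 h3
    have h4 : φ ζ ≠ 0 := fun h => h3 (by simp [slope_def_module, h, h0])
    simp only [Pi.smul_apply', Pi.inv_apply]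
    rw [← h2, smul_smul, inv_mul_cancel₀ h4, one_smul]
  · have hlim := (hslope.inv₀ h1).smul (hh.continuousAt.tendsto.mono_left nhdsWithin_le_nhds)
    refine hlim.congr' ?_
    filter_upwards [heq, hne, self_mem_nhdsWithin] with ζ h2 h3 h5
    have h4 : φ ζ ≠ 0 := fun h => h3 (by simp [slope_def_module, h, h0])
    rw [← h2, smul_smul]
    congr 1
    rw [slope_def_field, h0, sub_zero, inv_div, div_mul_cancel₀ _ h4]

theorem hasRegularValue_of_eventuallyEq {f h : ℂ → Fin 3 → ℂ} {w : ℂ} (hh : AnalyticAt ℂ h w)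
    (heq : ∀ᶠ ζ in 𝓝[≠] w, f ζ = h ζ) : HasRegularValue f w (h w) :=
  ⟨hh.meromorphicAt.congr (EventuallyEq.symm heq),
    (hh.continuousAt.tendsto.mono_left nhdsWithin_le_nhds).congr' (EventuallyEq.symm heq)⟩

/-! ### The coefficients of the Lax pair -/

theorem l_two (lam : ℂ) : l lam 2 = l lam 1 := rfl

theorem z_two (lam : ℂ) : z lam 2 = z lam 1 := rfl

theorem differentiable_k : Differentiable ℂ k := by
  unfold k
  fun_prop

theorem differentiable_l (i : Fin 3) : Differentiable ℂ (fun lam => l lam i) := by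
  unfold l
  have := differentiable_k
  fun_prop

theorem differentiable_z (i : Fin 3) : Differentiable ℂ (fun lam => z lam i) := by
  unfold z
  have := differentiable_k
  fun_prop

theorem differentiable_θ (i j : Fin 3) (x t : ℝ) : Differentiable ℂ (θ i j x t) := by
  unfold θ
  have h1 := differentiable_l i
  have h2 := differentiable_l j
  have h3 := differentiable_z i
  have h4 := differentiable_z j
  fun_prop

theorem trace_V1 (u v : ℝ → ℝ → ℂ) (lam : ℂ) (x t : ℝ) : (V1 u v lam x t).trace = 0 := by
  simp [V1, U1, Matrix.trace_fin_three]

theorem trace_V2 (u v : ℝ → ℝ → ℂ) (lam : ℂ) (x t : ℝ) : (V2 u v lam x t).trace = 0 := by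
  have h1 : star (u x t) * u x t = (‖u x t‖ : ℂ) ^ 2 := conj_mul' _
  have h2 : star (v x t) * v x t = (‖v x t‖ : ℂ) ^ 2 := conj_mul' _
  simp only [V2, U1, U2, U3, Matrix.trace_fin_three, Matrix.sub_apply, Matrix.add_apply,
    Matrix.smul_apply, Matrix.of_apply, Matrix.cons_val, h1, h2, density, smul_eq_mul]
  push_cast
  ring

theorem norm_Lam_sub_le (c : ℂ) (j a b : Fin 3) :
    ‖diagonal (fun i => c * (Lam i - Lam j)) a b‖ ≤ 2 * ‖c‖ := by
  rw [diagonal_apply]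
  split_ifs
  · rw [norm_mul, mul_comm]
    gcongr
    fin_cases a <;> fin_cases j <;> norm_num [Lam]
  · simp

variable {T : ℝ} {u v : ℝ → ℝ → ℂ}

theorem IsSolution.norm_U1_le (huv : IsSolution T u v) :
    ∃ C : ℝ, ∀ x t : ℝ, 0 ≤ x → t ∈ Icc 0 T → ∀ i m, ‖U1 u v x t i m‖ ≤ C / (1 + x) ^ 2 := by
  obtain ⟨C, hC⟩ := huv.decay
  refine ⟨C, fun x t hx ht i m => ?_⟩
  obtain ⟨h1, h2, -, -⟩ := hC x t hx ht
  have h0 : 0 ≤ C / (1 + x) ^ 2 := (norm_nonneg _).trans h1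
  fin_cases i <;> fin_cases m <;> simpa [U1]

theorem IsSolution.norm_boundary_le (huv : IsSolution T u v) :
    ∃ K : ℝ, ∀ t ∈ Icc 0 T, ∀ i m, ‖U1 u v 0 t i m‖ ≤ K ∧ ‖U2 u v 0 t i m‖ ≤ K ∧
      ‖U3 u v 0 t i m‖ ≤ K := by
  obtain ⟨C, hC⟩ := huv.decay
  -- With |u|² + |v|² ≤ 2C², the entries of `U3` are at most 2C + 2C³ + C and those of `U2` at most
  -- 2C²; the sum covers all cases.
  refine ⟨3 * C + 2 * C ^ 2 + 2 * C ^ 3, fun t ht i m => ?_⟩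
  obtain ⟨h1, h2, h3, h4⟩ := hC 0 t le_rfl ht
  simp only [add_zero, one_pow, div_one] at h1 h2 h3 h4
  have h0 : 0 ≤ C := (norm_nonneg _).trans h1
  have hd : ‖density u v 0 t‖ ≤ 2 * C ^ 2 := by
    rw [density, norm_real, Real.norm_of_nonneg (by positivity)]
    have h5 : ‖u 0 t‖ ^ 2 ≤ C ^ 2 := by gcongr
    have h6 : ‖v 0 t‖ ^ 2 ≤ C ^ 2 := by gcongr
    linarith
  have hmul : ∀ a b : ℂ, ‖a‖ ≤ C → ‖b‖ ≤ C → ‖a * b‖ ≤ 3 * C + 2 * C ^ 2 + 2 * C ^ 3 := by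
    intro a b ha hb
    rw [norm_mul]
    have := mul_le_mul ha hb (norm_nonneg _) h0
    nlinarith [pow_nonneg h0 3]
  have hsum : ∀ a b c : ℂ, ‖a‖ ≤ C → ‖b‖ ≤ C → ‖c‖ = 1 →
      ‖2 * a + a * density u v 0 t + c * b‖ ≤ 3 * C + 2 * C ^ 2 + 2 * C ^ 3 := by
    intro a b c ha hb hc
    refine norm_add₃_le.trans ?_
    rw [norm_mul, norm_mul, norm_mul, hc, norm_ofNat, one_mul]
    have := mul_le_mul ha hd (norm_nonneg _) h0
    nlinarith [pow_nonneg h0 2]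
  have hsum' : ∀ a b : ℂ, ‖a‖ ≤ C → ‖b‖ ≤ C →
      ‖2 * a + a * density u v 0 t - I * b‖ ≤ 3 * C + 2 * C ^ 2 + 2 * C ^ 3 := by
    intro a b ha hb
    simpa [sub_eq_add_neg] using hsum a b (-I) ha hb (by simp)
  have hpos : 0 ≤ 3 * C + 2 * C ^ 2 + 2 * C ^ 3 := by positivity
  have hC' : C ≤ 3 * C + 2 * C ^ 2 + 2 * C ^ 3 := by nlinarith [pow_nonneg h0 2, pow_nonneg h0 3]
  have hd' : ‖density u v 0 t‖ ≤ 3 * C + 2 * C ^ 2 + 2 * C ^ 3 := by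
    nlinarith [pow_nonneg h0 2, pow_nonneg h0 3]
  have h1' : ‖star (u 0 t)‖ ≤ C := by rwa [norm_star]
  have h2' : ‖star (v 0 t)‖ ≤ C := by rwa [norm_star]
  have h3' : ‖star (dx u 0 t)‖ ≤ C := by rwa [norm_star]
  have h4' : ‖star (dx v 0 t)‖ ≤ C := by rwa [norm_star]
  refine ⟨?_, ?_, ?_⟩
  · fin_cases i <;> fin_cases m <;>
      first
        | exact h1.trans hC' | exact h2.trans hC' | exact h1'.trans hC' | exact h2'.trans hC'
        | simpa [U1] using hpos
  · fin_cases i <;> fin_cases m <;>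
      first
        | exact hmul _ _ h1' h1 | exact hmul _ _ h1' h2 | exact hmul _ _ h2' h2
        | exact hmul _ _ h1 h2' | simpa [U2] using hd' | simpa [U2] using hpos
  · fin_cases i <;> fin_cases m <;>
      first
        | exact hsum' _ _ h1 h3 | exact hsum' _ _ h2 h4 | exact hsum _ _ _ h1' h3' norm_I
        | exact hsum _ _ _ h2' h4' norm_I | simpa [U3] using hpos

/-! ### The eigenfunction `μ₁` -/

variable {μ₁ : ℝ → ℝ → ℂ → Matrix (Fin 3) (Fin 3) ℂ}

theorem IsMu1.isStripSolution (h : IsMu1 T u v μ₁) (lam : ℂ) (j : Fin 3) :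
    IsStripSolution T (l lam) (z lam) (V1 u v lam) (V2 u v lam) j
      (fun x t => (μ₁ x t lam).col j) :=
  (h lam j).isStripSolution

theorem IsMu1.apply_T (h : IsMu1 T u v μ₁) (hT : 0 < T) (lam : ℂ) : μ₁ 0 T lam = 1 := by
  ext i j
  have := (h lam j).integral_eq 0 T le_rfl ⟨hT.le, le_rfl⟩ i
  rw [this, one_apply, contourIntegral]
  simp

/-- The solution is followed from the identity at (0, T) back to (0, t), then out to (x, t). On both
legs the coefficients are polynomial in λ. -/
theorem IsMu1.differentiable (h : IsMu1 T u v μ₁) (hT : 0 < T) (huv : IsSolution T u v)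
    {x t : ℝ} (hx : 0 ≤ x) (ht : t ∈ Icc 0 T) (j : Fin 3) :
    Differentiable ℂ (fun lam => (μ₁ x t lam).col j) := by
  obtain ⟨C, hC⟩ := huv.norm_U1_le
  obtain ⟨K, hK⟩ := huv.norm_boundary_le
  have hk := differentiable_k
  have h1 : Differentiable ℂ (fun lam => (μ₁ 0 t lam).col j) := by
    refine differentiable_of_solvesOn_reverse (ι := Fin 4) (K := max (2 * ‖2 * I‖) K) ht.2
      (c := ![fun w => k w ^ 2, fun w => -2 * w ^ 3, fun w => I * w ^ 2, fun w => -w])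
      (fun n => ?_)
      (B := ![fun _ => diagonal (fun i => 2 * I * (Lam i - Lam j)), fun τ => U1 u v 0 τ,
        fun τ => U2 u v 0 τ, fun τ => U3 u v 0 τ]) (fun n τ hτ i m => ?_)
      (l := z) (P := fun w τ => V2 u v w 0 τ) (j := j) (fun w τ _ => ?_)
      (f := fun w τ => (μ₁ 0 τ w).col j)
      (fun w => (h.isStripSolution w j).solves_t.mono (Icc_subset_Icc_left ht.1)) ?_
    · fin_cases n <;> simp <;> fun_prop
    · obtain ⟨h1, h2, h3⟩ := hK τ ⟨ht.1.trans hτ.1, hτ.2⟩ i m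
      fin_cases n
      · exact (norm_Lam_sub_le _ j _ _).trans (le_max_left _ _)
      · exact h1.trans (le_max_right _ _)
      · exact h2.trans (le_max_right _ _)
      · exact h3.trans (le_max_right _ _)
    · have hz : diagonal (fun i => z w i - z w j) =
          k w ^ 2 • diagonal (fun i => 2 * I * (Lam i - Lam j)) := by
        rw [← diagonal_smul]
        congr 1
        ext i
        simp only [z, Pi.smul_apply, smul_eq_mul]
        ring
      simp only [Fin.sum_univ_four, hz, V2, Matrix.cons_val, neg_smul]
      abel
    · simp only [h.apply_T hT]
      exact differentiable_const _
  refine differentiable_of_solvesOn (ι := Fin 2) (K := max (2 * ‖-I‖) C) hx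
      (c := ![k, fun w => w]) (fun n => ?_)
      (B := ![fun _ => diagonal (fun i => -I * (Lam i - Lam j)), fun y => U1 u v y t])
      (fun n y hy i m => ?_)
      (l := l) (P := fun w y => V1 u v w y t) (j := j) (fun w y _ => ?_)
      (f := fun w y => (μ₁ y t w).col j)
      (fun w => ((h.isStripSolution w j).solves_x t ht).mono Icc_subset_Ici_self) h1
  · fin_cases n
    exacts [hk, differentiable_id]
  · fin_cases n
    · exact (norm_Lam_sub_le _ j _ _).trans (le_max_left _ _)
    · have h2 := hC y t hy.1 ht i m
      have h3 : 0 ≤ C := by simpa using (norm_nonneg _).trans (hC 0 t le_rfl ht i m)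
      refine h2.trans ((div_le_self h3 ?_).trans (le_max_right _ _))
      nlinarith [hy.1]
  · have hl : diagonal (fun i => l w i - l w j) =
        k w • diagonal (fun i => -I * (Lam i - Lam j)) := by
      rw [← diagonal_smul]
      congr 1
      ext i
      simp only [l, Pi.smul_apply, smul_eq_mul]
      ring
    simp only [Fin.sum_univ_two, hl, V1, Matrix.cons_val]

theorem IsMu1.differentiable_apply (h : IsMu1 T u v μ₁) (hT : 0 < T) (huv : IsSolution T u v)
    {x t : ℝ} (hx : 0 ≤ x) (ht : t ∈ Icc 0 T) (i j : Fin 3) :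
    Differentiable ℂ (fun lam => μ₁ x t lam i j) :=
  differentiable_pi.1 (h.differentiable hT huv hx ht j) i

theorem IsMu1.differentiable_cofactor (h : IsMu1 T u v μ₁) (hT : 0 < T)
    (huv : IsSolution T u v) {x t : ℝ} (hx : 0 ≤ x) (ht : t ∈ Icc 0 T) (i j : Fin 3) :
    Differentiable ℂ (fun lam => cofactor (μ₁ x t lam) i j) := by
  have := fun i j => h.differentiable_apply hT huv hx ht i j
  simp only [cofactor, minor, Matrix.of_apply, det_fin_two, submatrix_apply]
  fun_prop

theorem IsMu1.det_eq_one (h : IsMu1 T u v μ₁) (hT : 0 < T) (lam : ℂ) {x t : ℝ} (hx : 0 ≤ x)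
    (ht : t ∈ Icc 0 T) : (μ₁ x t lam).det = 1 :=
  CMNLS.det_eq_one (trace_V1 u v lam) (trace_V2 u v lam) (Φ := fun x t => μ₁ x t lam)
    (h.isStripSolution lam) ⟨hT.le, le_rfl⟩ (h.apply_T hT lam) hx ht

/-- The matrix that maps the value at the origin of a column of index `j` to its value at
`(x, t)`. -/
noncomputable def propagator (μ₁ : ℝ → ℝ → ℂ → Matrix (Fin 3) (Fin 3) ℂ) (x t : ℝ) (j : Fin 3) (lam : ℂ) :
    Matrix (Fin 3) (Fin 3) ℂ :=
  μ₁ x t lam * diagonal (fun m => exp (θ m j x t lam)) * (cofactor (μ₁ 0 0 lam))ᵀ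

/-- Columns of different index are propagated by the same matrix up to a scalar. A linear relation
between columns at the origin thereby survives at (x, t), with the factor e^θ of the residue
formulas. -/
theorem propagator_eq_smul (x t : ℝ) (i j : Fin 3) (lam : ℂ) :
    propagator μ₁ x t j lam = exp (θ i j x t lam) • propagator μ₁ x t i lam := by
  have : diagonal (fun m => exp (θ m j x t lam)) =
      exp (θ i j x t lam) • diagonal (fun m => exp (θ m i x t lam)) := by
    rw [← diagonal_smul]
    congr 1
    ext m
    rw [Pi.smul_apply, smul_eq_mul, ← exp_add]
    congr 1
    simp only [θ]
    ring
  rw [propagator, propagator, this, Matrix.mul_smul, Matrix.smul_mul]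

theorem analyticAt_propagator_mulVec (h : IsMu1 T u v μ₁) (hT : 0 < T) (huv : IsSolution T u v)
    {x t : ℝ} (hx : 0 ≤ x) (ht : t ∈ Icc 0 T) (j : Fin 3) {g : ℂ → Fin 3 → ℂ} {w : ℂ}
    (hg : ∀ i, AnalyticAt ℂ (fun ζ => g ζ i) w) :
    AnalyticAt ℂ (fun ζ => propagator μ₁ x t j ζ *ᵥ g ζ) w := by
  refine AnalyticAt.pi fun i => ?_
  have h1 := fun i m => (h.differentiable_apply hT huv hx ht i m).analyticAt w
  have h2 := fun i m =>
    (h.differentiable_cofactor hT huv le_rfl ⟨le_rfl, hT.le⟩ i m).analyticAt w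
  have h3 := fun m => ((differentiable_θ m j x t).cexp).analyticAt w
  simp only [propagator, mulVec, dotProduct, mul_apply, transpose_apply, diagonal_apply,
    mul_ite, mul_zero, Finset.sum_ite_eq', Finset.mem_univ, if_true]
  refine Finset.analyticAt_fun_sum _ fun m _ => AnalyticAt.fun_mul ?_ (hg m)
  exact Finset.analyticAt_fun_sum _ fun n _ => ((h1 _ _).fun_mul (h3 _)).fun_mul (h2 _ _)

/-- This confines the (x, t)-dependence to an entire matrix, leaving only values at the origin to be
studied. -/
theorem IsMu1.eq_propagator_mulVec (h : IsMu1 T u v μ₁) (hT : 0 < T) {lam : ℂ} {j : Fin 3}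
    {f : ℝ → ℝ → Fin 3 → ℂ}
    (hf : IsStripSolution T (l lam) (z lam) (V1 u v lam) (V2 u v lam) j f)
    {x t : ℝ} (hx : 0 ≤ x) (ht : t ∈ Icc 0 T) : f x t = propagator μ₁ x t j lam *ᵥ f 0 0 :=
  hf.eq_mulVec (trace_V1 u v lam) (trace_V2 u v lam) (Φ := fun x t => μ₁ x t lam)
    (h.isStripSolution lam) ⟨hT.le, le_rfl⟩ (h.apply_T hT lam) hx ht

/-! ### Behaviour of eigencolumns at infinity and at the corners -/

section Eigencolumn

variable {T : ℝ} {l z : Fin 3 → ℂ} {P Q : ℝ → ℝ → Matrix (Fin 3) (Fin 3) ℂ}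
  {c : Fin 3 → Contour} {i j j' : Fin 3} {f : ℝ → ℝ → Fin 3 → ℂ} {C t : ℝ}

theorem IsBounded.norm_apply_le (h : IsBounded T f) (ht : t ∈ Icc 0 T) :
    ∃ B, ∀ x, 0 ≤ x → ∀ i, ‖f x t i‖ ≤ B := by
  obtain ⟨B, hB⟩ := h
  exact ⟨B, fun x hx i => (norm_le_pi_norm _ i).trans (hB x t hx ht)⟩

theorem IsEigencolumn.isJostColumn (h : IsEigencolumn T l z P Q (fun _ => .γ₃) j f)
    (hb : IsBounded T f) (hl : ∀ i, (l j).re ≤ (l i).re) (ht : t ∈ Icc 0 T)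
    (hP : ∀ x, 0 ≤ x → ∀ i m, ‖P x t i m‖ ≤ C / (1 + x) ^ 2) :
    IsJostColumn l (fun x => P x t) C j (fun x => f x t) where
  solves := h.isStripSolution.solves_x t ht
  re_le := hl
  norm_coeff_le := hP
  integral_eq x hx i := h.integral_eq x t hx ht i
  bounded := hb.norm_apply_le ht

theorem IsEigencolumn.tendsto (h : IsEigencolumn T l z P Q c j f) (hb : IsBounded T f)
    (hc : c i = .γ₃) (hl : (l j).re ≤ (l i).re) (ht : t ∈ Icc 0 T)
    (hP : ∀ x, 0 ≤ x → ∀ i m, ‖P x t i m‖ ≤ C / (1 + x) ^ 2) :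
    Tendsto (fun x => f x t i) atTop (𝓝 (if i = j then 1 else 0)) := by
  obtain ⟨B, hB⟩ := hb.norm_apply_le ht
  refine tendsto_of_integral_eq hl hP hB fun x hx => ?_
  rw [h.integral_eq x t hx ht i, hc]
  rfl

/-- At the starting point of γ₁ both integrals run over degenerate intervals. -/
theorem IsEigencolumn.apply_T (h : IsEigencolumn T l z P Q c j f) (hT : 0 < T)
    (hc : c i = .γ₁) : f 0 T i = if i = j then 1 else 0 := by
  rw [h.integral_eq 0 T le_rfl ⟨hT.le, le_rfl⟩ i, hc]
  simp [contourIntegral]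

theorem IsEigencolumn.apply_zero (h : IsEigencolumn T l z P Q c j f) (hT : 0 < T)
    (hc : c i = .γ₂) : f 0 0 i = if i = j then 1 else 0 := by
  rw [h.integral_eq 0 0 le_rfl ⟨le_rfl, hT.le⟩ i, hc]
  simp [contourIntegral]

/-- The pairing of columns with the same exponentials, evaluated at infinity. -/
theorem SolvesOn.pairing_of_tendsto {P : ℝ → Matrix (Fin 3) (Fin 3) ℂ} {f g : ℝ → Fin 3 → ℂ}
    (hf : SolvesOn l P j f (Ici 0)) (hg : SolvesOn (-l) (fun x => -(P x)ᵀ) j' g (Ici 0))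
    (hl : l j = l j') (hb : ∃ B, ∀ x, 0 ≤ x → ∀ i, ‖f x i‖ ≤ B)
    (hf' : Tendsto (fun x => f x j') atTop (𝓝 (if j' = j then 1 else 0)))
    (hg' : ∀ i, Tendsto (fun x => g x i) atTop (𝓝 (if i = j' then 1 else 0))) :
    f 0 ⬝ᵥ g 0 = if j' = j then 1 else 0 := by
  obtain ⟨B, hB⟩ := hb
  -- Only entry j' of f needs a known limit. The other entries are merely bounded, but they meet
  -- entries of g that tend to 0.
  have hterm : ∀ i, Tendsto (fun x => f x i * g x i) atTop
      (𝓝 (if i = j' then (if j' = j then 1 else 0) else 0)) := by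
    intro i
    by_cases h : i = j'
    · subst h
      simpa using hf'.mul (hg' i)
    · have h0 := hg' i
      rw [if_neg h] at h0 ⊢
      refine squeeze_zero_norm' ?_ (by simpa using h0.norm.const_mul B)
      filter_upwards [eventually_ge_atTop 0] with x hx
      rw [norm_mul]
      gcongr
      exact hB x hx i
  have hsum := tendsto_finsetSum Finset.univ fun i _ => hterm i
  rw [Finset.sum_ite_eq' Finset.univ j', if_pos (Finset.mem_univ _)] at hsum
  have hconst : ∀ᶠ x in atTop, ∑ i, f x i * g x i = f 0 ⬝ᵥ g 0 := by
    filter_upwards [eventually_ge_atTop 0] with x hx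
    have := hf.pairing_eq (convex_Ici 0) hg (mem_Ici.2 hx) (mem_Ici.2 le_rfl)
    simp only [hl, sub_self, zero_mul, exp_zero, mul_one] at this
    exact this
  exact tendsto_nhds_unique (tendsto_const_nhds.congr' (EventuallyEq.symm hconst)) hsum

end Eigencolumn

/-! ### The eigenfunctions normalized at infinity -/

variable {T : ℝ} {u v : ℝ → ℝ → ℂ} {μ₁ μ₃ μ₃A : ℝ → ℝ → ℂ → Matrix (Fin 3) (Fin 3) ℂ} {C : ℝ}

theorem norm_V1_le {lam : ℂ} {x t : ℝ} {i m : Fin 3} (h : ‖U1 u v x t i m‖ ≤ C / (1 + x) ^ 2) :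
    ‖V1 u v lam x t i m‖ ≤ ‖lam‖ * C / (1 + x) ^ 2 := by
  rw [V1, Matrix.smul_apply, norm_smul, mul_div_assoc]
  gcongr

theorem IsMu3.isJostColumn (h : IsMu3 T u v μ₃) {t : ℝ} (ht : t ∈ Icc 0 T)
    (hC : ∀ x t : ℝ, 0 ≤ x → t ∈ Icc 0 T → ∀ i m, ‖U1 u v x t i m‖ ≤ C / (1 + x) ^ 2)
    {lam : ℂ} {j : Fin 3} (hl : ∀ i, (l lam j).re ≤ (l lam i).re) :
    IsJostColumn (l lam) (fun x => V1 u v lam x t) (‖lam‖ * C) j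
      (fun x => (μ₃ x t lam).col j) :=
  (h lam j hl).1.isJostColumn (h lam j hl).2 hl ht fun x hx i m => norm_V1_le (hC x t hx ht i m)

theorem IsMu3A.isJostColumn (h : IsMu3A T u v μ₃A) {t : ℝ} (ht : t ∈ Icc 0 T)
    (hC : ∀ x t : ℝ, 0 ≤ x → t ∈ Icc 0 T → ∀ i m, ‖U1 u v x t i m‖ ≤ C / (1 + x) ^ 2)
    {lam : ℂ} {j : Fin 3} (hl : ∀ i, (l lam i).re ≤ (l lam j).re) :
    IsJostColumn (-l lam) (fun x => -(V1 u v lam x t)ᵀ) (‖lam‖ * C) j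
      (fun x => (μ₃A x t lam).col j) :=
  (h lam j hl).1.isJostColumn (h lam j hl).2 (fun i => by simpa using hl i) ht
    fun x hx i m => by simpa using norm_V1_le (lam := lam) (hC x t hx ht m i)

/-- The half-plane `Re l₁ < Re l₂`, which contains `D₁` and `D₂`. -/
def upper : Set ℂ := {lam | (l lam 0).re < (l lam 1).re}

/-- The half-plane `Re l₂ < Re l₁`, which contains `D₃` and `D₄`. -/
def lower : Set ℂ := {lam | (l lam 1).re < (l lam 0).re}

theorem continuous_re_l (i : Fin 3) : Continuous (fun lam => (l lam i).re) :=
  continuous_re.comp (differentiable_l i).continuous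

theorem continuous_re_z (i : Fin 3) : Continuous (fun lam => (z lam i).re) :=
  continuous_re.comp (differentiable_z i).continuous

theorem isOpen_upper : IsOpen upper := isOpen_lt (continuous_re_l 0) (continuous_re_l 1)

theorem isOpen_lower : IsOpen lower := isOpen_lt (continuous_re_l 1) (continuous_re_l 0)

theorem isOpen_D₁ : IsOpen D₁ := isOpen_upper.inter (isOpen_lt (continuous_re_z 1) (continuous_re_z 0))

theorem isOpen_D₂ : IsOpen D₂ := isOpen_upper.inter (isOpen_lt (continuous_re_z 0) (continuous_re_z 1))

theorem isOpen_D₃ : IsOpen D₃ := isOpen_lower.inter (isOpen_lt (continuous_re_z 1) (continuous_re_z 0))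

theorem isOpen_D₄ : IsOpen D₄ := isOpen_lower.inter (isOpen_lt (continuous_re_z 0) (continuous_re_z 1))

theorem re_l_zero_le {lam : ℂ} (h : lam ∈ upper) (i : Fin 3) : (l lam 0).re ≤ (l lam i).re := by
  have h' : (l lam 0).re < (l lam 1).re := h
  fin_cases i
  · exact le_rfl
  · exact h'.le
  · exact h'.le

theorem re_l_le_of_ne_zero {lam : ℂ} (h : lam ∈ upper) {j : Fin 3} (hj : j ≠ 0) (i : Fin 3) :
    (l lam i).re ≤ (l lam j).re := by
  have h' : (l lam 0).re < (l lam 1).re := h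
  fin_cases j
  · exact absurd rfl hj
  · fin_cases i
    exacts [h'.le, le_rfl, le_rfl]
  · fin_cases i
    exacts [h'.le, le_rfl, le_rfl]

theorem re_l_le_zero {lam : ℂ} (h : lam ∈ lower) (i : Fin 3) : (l lam i).re ≤ (l lam 0).re := by
  have h' : (l lam 1).re < (l lam 0).re := h
  fin_cases i
  · exact le_rfl
  · exact h'.le
  · exact h'.le

theorem re_l_ge_of_ne_zero {lam : ℂ} (h : lam ∈ lower) {j : Fin 3} (hj : j ≠ 0) (i : Fin 3) :
    (l lam j).re ≤ (l lam i).re := by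
  have h' : (l lam 1).re < (l lam 0).re := h
  fin_cases j
  · exact absurd rfl hj
  · fin_cases i
    exacts [h'.le, le_rfl, le_rfl]
  · fin_cases i
    exacts [h'.le, le_rfl, le_rfl]

/-- The second and the third columns of `s` are holomorphic in the lower half-plane. -/
theorem differentiableOn_spec_mu3 (hT : 0 < T) (huv : IsSolution T u v) (hμ₁ : IsMu1 T u v μ₁)
    (hμ₃ : IsMu3 T u v μ₃) {j : Fin 3} (hj : j ≠ 0) (i : Fin 3) :
    DifferentiableOn ℂ (fun lam => μ₃ 0 0 lam i j) lower := by
  obtain ⟨C, hC⟩ := huv.norm_U1_le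
  have h0 : (0 : ℝ) ∈ Icc 0 T := ⟨le_rfl, hT.le⟩
  exact differentiableOn_jostColumn isOpen_lower (C := fun lam => ‖lam‖ * C)
    (continuous_norm.mul continuous_const)
    (Φ := fun lam x => μ₁ x 0 lam) (Γ := fun lam x => cofactor (μ₁ x 0 lam))
    (fun lam m => (hμ₁.isStripSolution lam m).solves_x 0 h0)
    (fun lam x hx => by rw [mul_transpose_cofactor, hμ₁.det_eq_one hT lam hx h0, one_smul])
    differentiable_l (fun i m => hμ₁.differentiable_apply hT huv le_rfl h0 i m)
    (fun x hx i m => hμ₁.differentiable_cofactor hT huv hx h0 i m)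
    (fun lam hlam => hμ₃.isJostColumn h0 hC (re_l_ge_of_ne_zero hlam hj)) i

/-- The second and the third columns of `sᴬ` are holomorphic in the upper half-plane. -/
theorem differentiableOn_spec_mu3A (hT : 0 < T) (huv : IsSolution T u v) (hμ₁ : IsMu1 T u v μ₁)
    (hμ₃A : IsMu3A T u v μ₃A) {j : Fin 3} (hj : j ≠ 0) (i : Fin 3) :
    DifferentiableOn ℂ (fun lam => μ₃A 0 0 lam i j) upper := by
  obtain ⟨C, hC⟩ := huv.norm_U1_le
  have h0 : (0 : ℝ) ∈ Icc 0 T := ⟨le_rfl, hT.le⟩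
  exact differentiableOn_jostColumn isOpen_upper (C := fun lam => ‖lam‖ * C)
    (continuous_norm.mul continuous_const)
    -- For the adjugate system the roles are exchanged: the cofactor matrix is fundamental and `μ₁`
    -- is its inverse transpose.
    (Φ := fun lam x => cofactor (μ₁ x 0 lam)) (Γ := fun lam x => μ₁ x 0 lam)
    (fun lam m => (isStripSolution_cofactor (Φ := fun x t => μ₁ x t lam) (trace_V1 u v lam)
      (trace_V2 u v lam) (hμ₁.isStripSolution lam) m).solves_x 0 h0)
    (fun lam x hx => by rw [cofactor_mul_transpose, hμ₁.det_eq_one hT lam hx h0, one_smul])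
    (fun i => (differentiable_l i).neg)
    (fun i m => hμ₁.differentiable_cofactor hT huv le_rfl h0 i m)
    (fun x hx i m => hμ₁.differentiable_apply hT huv hx h0 i m)
    (fun lam hlam => hμ₃A.isJostColumn h0 hC (re_l_le_of_ne_zero hlam hj)) i

theorem tendsto_cross_one_two {f g : ℝ → Fin 3 → ℂ}
    (hf : ∀ i, Tendsto (fun x => f x i) atTop (𝓝 (if i = 1 then 1 else 0)))
    (hg : ∀ i, Tendsto (fun x => g x i) atTop (𝓝 (if i = 2 then 1 else 0))) (i : Fin 3) :
    Tendsto (fun x => (f x ⨯₃ g x) i) atTop (𝓝 (if i = 0 then 1 else 0)) := by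
  have h := fun a b => (hf a).mul (hg b)
  fin_cases i
  · simpa [cross_apply] using (h 1 2).sub (h 2 1)
  · simpa [cross_apply] using (h 2 0).sub (h 0 2)
  · simpa [cross_apply] using (h 0 1).sub (h 1 0)

/-- In the upper half-plane the first column of `s` is a cross product of columns of `sᴬ`. -/
theorem spec_mu3_eq_cross (hT : 0 < T) (huv : IsSolution T u v) (hμ₃ : IsMu3 T u v μ₃)
    (hμ₃A : IsMu3A T u v μ₃A) {lam : ℂ} (hlam : lam ∈ upper) :
    (μ₃ 0 0 lam).col 0 = (μ₃A 0 0 lam).col 1 ⨯₃ (μ₃A 0 0 lam).col 2 := by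
  obtain ⟨C, hC⟩ := huv.norm_U1_le
  have h0 : (0 : ℝ) ∈ Icc 0 T := ⟨le_rfl, hT.le⟩
  have h1 := hμ₃A.isJostColumn h0 hC (re_l_le_of_ne_zero hlam one_ne_zero)
  have h2 := hμ₃A.isJostColumn h0 hC (re_l_le_of_ne_zero hlam (j := 2) (by decide))
  -- The cross product solves the adjugate of the adjugate, which is the original system, and tends
  -- to the first unit vector; uniqueness at infinity identifies it.
  have h3 := h1.solves.cross (j₀ := 0) rfl
    (fun x _ => by rw [trace_neg, trace_transpose, trace_V1, neg_zero]) h2.solves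
  simp only [neg_neg, transpose_neg, transpose_transpose] at h3
  exact ((hμ₃.isJostColumn h0 hC (re_l_zero_le hlam)).eq_of_tendsto h3
    (tendsto_cross_one_two h1.tendsto h2.tendsto) le_rfl).symm

/-- In the lower half-plane the first column of `sᴬ` is a cross product of columns of `s`. -/
theorem spec_mu3A_eq_cross (hT : 0 < T) (huv : IsSolution T u v) (hμ₃ : IsMu3 T u v μ₃)
    (hμ₃A : IsMu3A T u v μ₃A) {lam : ℂ} (hlam : lam ∈ lower) :
    (μ₃A 0 0 lam).col 0 = (μ₃ 0 0 lam).col 1 ⨯₃ (μ₃ 0 0 lam).col 2 := by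
  obtain ⟨C, hC⟩ := huv.norm_U1_le
  have h0 : (0 : ℝ) ∈ Icc 0 T := ⟨le_rfl, hT.le⟩
  have h1 := hμ₃.isJostColumn h0 hC (re_l_ge_of_ne_zero hlam one_ne_zero)
  have h2 := hμ₃.isJostColumn h0 hC (re_l_ge_of_ne_zero hlam (j := 2) (by decide))
  have h3 := h1.solves.cross (j₀ := 0) rfl (fun x _ => trace_V1 u v lam x 0) h2.solves
  exact ((hμ₃A.isJostColumn h0 hC (re_l_le_zero hlam)).eq_of_tendsto h3
    (tendsto_cross_one_two h1.tendsto h2.tendsto) le_rfl).symm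

/-! ### The values of the sectional eigenfunction at the origin -/

variable {lam : ℂ} {c : Fin 3 → Contour} {f : ℝ → ℝ → Fin 3 → ℂ}

theorem IsLaxColumn.eq_spec_mu3 (hT : 0 < T) (huv : IsSolution T u v) (hμ₃ : IsMu3 T u v μ₃)
    {j : Fin 3} (hl : ∀ i, (l lam j).re ≤ (l lam i).re) (hf : IsLaxColumn T u v lam c j f)
    (hb : IsBounded T f) (hc : ∀ i, c i = .γ₃) : f 0 0 = (μ₃ 0 0 lam).col j := by
  obtain ⟨C, hC⟩ := huv.norm_U1_le
  have h0 : (0 : ℝ) ∈ Icc 0 T := ⟨le_rfl, hT.le⟩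
  exact (hμ₃.isJostColumn h0 hC hl).eq_of_tendsto (hf.isStripSolution.solves_x 0 h0)
    (fun i => IsEigencolumn.tendsto hf hb (hc i) (hl i) h0 fun x hx i m =>
      norm_V1_le (hC x 0 hx h0 i m)) le_rfl

/-- Equal exponents make the pairing constant in x, and its value is read off at infinity. It
retains the normalization of the rows on γ₃ even when another row uses a different contour. -/
theorem IsLaxColumn.pairing_spec_mu3A (hT : 0 < T) (huv : IsSolution T u v)
    (hμ₃A : IsMu3A T u v μ₃A) {j j' : Fin 3} (hl : ∀ i, (l lam i).re ≤ (l lam j').re)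
    (hjj : l lam j = l lam j') (hf : IsLaxColumn T u v lam c j f) (hb : IsBounded T f)
    (hc : c j' = .γ₃) : f 0 0 ⬝ᵥ (μ₃A 0 0 lam).col j' = if j' = j then 1 else 0 := by
  obtain ⟨C, hC⟩ := huv.norm_U1_le
  have h0 : (0 : ℝ) ∈ Icc 0 T := ⟨le_rfl, hT.le⟩
  have hJ := hμ₃A.isJostColumn h0 hC hl
  exact (hf.isStripSolution.solves_x 0 h0).pairing_of_tendsto hJ.solves hjj
    (hb.norm_apply_le h0) (IsEigencolumn.tendsto hf hb hc (congrArg re hjj).le h0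
      fun x hx i m => norm_V1_le (hC x 0 hx h0 i m)) hJ.tendsto

/-- At (0, T) the cofactor matrix is the identity, so the pairing there is entry i of f, which
vanishes on γ₁. Transport to the origin multiplies it only by an exponential. -/
theorem IsLaxColumn.pairing_cofactor (hT : 0 < T) (hμ₁ : IsMu1 T u v μ₁) {i j : Fin 3}
    (hf : IsLaxColumn T u v lam c j f) (hij : i ≠ j) (hc : c i = .γ₁) :
    f 0 0 ⬝ᵥ (cofactor (μ₁ 0 0 lam)).col i = 0 := by
  have h0 : (0 : ℝ) ∈ Icc 0 T := ⟨le_rfl, hT.le⟩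
  have hg := isStripSolution_cofactor (Φ := fun x t => μ₁ x t lam) (trace_V1 u v lam)
    (trace_V2 u v lam) (hμ₁.isStripSolution lam) i
  have h := hf.isStripSolution.pairing_eq hg le_rfl h0 ⟨hT.le, le_rfl⟩
  have h1 : cofactor (1 : Matrix (Fin 3) (Fin 3) ℂ) = 1 := by
    simp [cofactor_eq_transpose_adjugate]
  have h2 : f 0 T ⬝ᵥ (1 : Matrix (Fin 3) (Fin 3) ℂ).col i = f 0 T i := by
    simp [dotProduct, Matrix.col_apply, one_apply]
  rw [hμ₁.apply_T hT lam, h1, h2, hf.apply_T hT hc, if_neg hij] at h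
  simpa using h

/-! ### Linear algebra of the residues -/

/-- This is Cramer's rule in the dual basis. It remains valid when a, b, c are dependent. -/
theorem triple_product_smul_eq (a b c w : Fin 3 → ℂ) :
    (a ⬝ᵥ b ⨯₃ c) • w =
      (w ⬝ᵥ a) • (b ⨯₃ c) + (w ⬝ᵥ b) • (c ⨯₃ a) + (w ⬝ᵥ c) • (a ⨯₃ b) := by
  ext i
  simp only [cross_apply, dotProduct, Fin.sum_univ_three, Pi.add_apply, Pi.smul_apply,
    smul_eq_mul, Matrix.cons_val]
  fin_cases i <;> simp only [Fin.zero_eta, Fin.mk_one, Fin.reduceFinMk, Matrix.cons_val] <;> ring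

/-- The three cross products are the columns of the cofactor matrix of a singular matrix, which has
rank at most 1. The second entry of b × c fixes the proportionality factors. -/
theorem cross_eq_smul_cross {a b c : Fin 3 → ℂ} (h : a ⬝ᵥ b ⨯₃ c = 0) (h1 : (b ⨯₃ c) 1 ≠ 0) :
    c ⨯₃ a = ((c ⨯₃ a) 1 / (b ⨯₃ c) 1) • (b ⨯₃ c) ∧
      a ⨯₃ b = ((a ⨯₃ b) 1 / (b ⨯₃ c) 1) • (b ⨯₃ c) := by
  have key1 : (b ⨯₃ c) 1 • (c ⨯₃ a) = (c ⨯₃ a) 1 • (b ⨯₃ c) := by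
    ext i
    simp only [cross_apply, dotProduct, Fin.sum_univ_three, Pi.smul_apply, smul_eq_mul,
      Matrix.cons_val] at h ⊢
    fin_cases i <;> simp only [Fin.zero_eta, Fin.mk_one, Fin.reduceFinMk, Matrix.cons_val]
    · linear_combination -c 2 * h
    · ring
    · linear_combination c 0 * h
  have key2 : (b ⨯₃ c) 1 • (a ⨯₃ b) = (a ⨯₃ b) 1 • (b ⨯₃ c) := by
    ext i
    simp only [cross_apply, dotProduct, Fin.sum_univ_three, Pi.smul_apply, smul_eq_mul,
      Matrix.cons_val] at h ⊢
    fin_cases i <;> simp only [Fin.zero_eta, Fin.mk_one, Fin.reduceFinMk, Matrix.cons_val]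
    · linear_combination b 2 * h
    · ring
    · linear_combination -b 0 * h
  constructor
  · rw [div_eq_inv_mul, mul_smul, ← key1, smul_smul, inv_mul_cancel₀ h1, one_smul]
  · rw [div_eq_inv_mul, mul_smul, ← key2, smul_smul, inv_mul_cancel₀ h1, one_smul]

theorem analyticAt_cross {a b : ℂ → Fin 3 → ℂ} {w : ℂ} (ha : ∀ i, AnalyticAt ℂ (fun ζ => a ζ i) w)
    (hb : ∀ i, AnalyticAt ℂ (fun ζ => b ζ i) w) (i : Fin 3) :
    AnalyticAt ℂ (fun ζ => (a ζ ⨯₃ b ζ) i) w := by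
  have h := fun i j => (ha i).fun_mul (hb j)
  fin_cases i
  · simpa [cross_apply] using (h 1 2).fun_sub (h 2 1)
  · simpa [cross_apply] using (h 2 0).fun_sub (h 0 2)
  · simpa [cross_apply] using (h 0 1).fun_sub (h 1 0)

theorem analyticAt_dotProduct {a b : ℂ → Fin 3 → ℂ} {w : ℂ}
    (ha : ∀ i, AnalyticAt ℂ (fun ζ => a ζ i) w) (hb : ∀ i, AnalyticAt ℂ (fun ζ => b ζ i) w) :
    AnalyticAt ℂ (fun ζ => a ζ ⬝ᵥ b ζ) w :=
  Finset.analyticAt_fun_sum _ fun i _ => (ha i).fun_mul (hb i)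

variable {T : ℝ} {u v : ℝ → ℝ → ℂ} {μ₁ M : ℝ → ℝ → ℂ → Matrix (Fin 3) (Fin 3) ℂ} {x t : ℝ}
  {w : ℂ} {φ : ℂ → ℂ}

/-- Residues of the second and the third column, given by their pairings at the origin. -/
theorem residues_upper (hT : 0 < T) (huv : IsSolution T u v) (hμ₁ : IsMu1 T u v μ₁)
    (hx : 0 ≤ x) (ht : t ∈ Icc 0 T) {a b c : ℂ → Fin 3 → ℂ}
    (ha : ∀ i, AnalyticAt ℂ (fun ζ => a ζ i) w) (hb : ∀ i, AnalyticAt ℂ (fun ζ => b ζ i) w)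
    (hc : ∀ i, AnalyticAt ℂ (fun ζ => c ζ i) w) (hφ : φ =ᶠ[𝓝 w] fun ζ => a ζ ⬝ᵥ b ζ ⨯₃ c ζ)
    (h0 : φ w = 0) (h1 : deriv φ w ≠ 0) (hs : (b w ⨯₃ c w) 1 ≠ 0)
    (hM : ∀ᶠ ζ in 𝓝[≠] w, ∀ j, column M x t j ζ = propagator μ₁ x t j ζ *ᵥ column M 0 0 j ζ)
    (hM0 : ∀ᶠ ζ in 𝓝[≠] w, column M 0 0 0 ζ = b ζ ⨯₃ c ζ)
    (hMa : ∀ᶠ ζ in 𝓝[≠] w, ∀ j ≠ 0, column M 0 0 j ζ ⬝ᵥ a ζ = 0)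
    (hMb : ∀ᶠ ζ in 𝓝[≠] w, ∀ j ≠ 0, column M 0 0 j ζ ⬝ᵥ b ζ = if 1 = j then 1 else 0)
    (hMc : ∀ᶠ ζ in 𝓝[≠] w, ∀ j ≠ 0, column M 0 0 j ζ ⬝ᵥ c ζ = if 2 = j then 1 else 0) :
    ∃ A, HasRegularValue (column M x t 0) w A ∧
      HasSimpleResidue (column M x t 1) w
        (((c w ⨯₃ a w) 1 / (deriv φ w * (b w ⨯₃ c w) 1) * exp (θ 0 2 x t w)) • A) ∧
      HasSimpleResidue (column M x t 2) w
        (((a w ⨯₃ b w) 1 / (deriv φ w * (b w ⨯₃ c w) 1) * exp (θ 0 2 x t w)) • A) := by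
  have hprop := fun j {g : ℂ → Fin 3 → ℂ} (hg : ∀ i, AnalyticAt ℂ (fun ζ => g ζ i) w) =>
    analyticAt_propagator_mulVec hμ₁ hT huv hx ht j hg
  have hφa : AnalyticAt ℂ φ w :=
    (analyticAt_dotProduct ha (analyticAt_cross hb hc)).congr hφ.symm
  have hzero : a w ⬝ᵥ b w ⨯₃ c w = 0 := hφ.self_of_nhds.symm.trans h0
  obtain ⟨hca, hab⟩ := cross_eq_smul_cross hzero hs
  refine ⟨_, hasRegularValue_of_eventuallyEq (hprop 0 (analyticAt_cross hb hc)) ?_, ?_, ?_⟩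
  · filter_upwards [hM, hM0] with ζ h2 h3
    rw [h2, h3]
  · have key := hasSimpleResidue_of_smul_eq (f := column M x t 1)
      (hprop 1 (analyticAt_cross hc ha)) hφa h0 h1 (by
        filter_upwards [hM, hMa, hMb, hMc, nhdsWithin_le_nhds hφ] with ζ h2 h3 h4 h5 h6
        rw [h2, ← mulVec_smul, h6, triple_product_smul_eq, h3 1 one_ne_zero, h4 1 one_ne_zero,
          h5 1 one_ne_zero]
        simp)
    convert! key using 1
    generalize (c w ⨯₃ a w) 1 = y at hca ⊢
    rw [propagator_eq_smul x t 0 1 w, hca, smul_mulVec, mulVec_smul, smul_smul, smul_smul]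
    congr 1
    -- The last two exponents coincide, so a single exponential serves both columns.
    rw [show θ 0 2 x t w = θ 0 1 x t w from rfl]
    field_simp
  · have key := hasSimpleResidue_of_smul_eq (f := column M x t 2)
      (hprop 2 (analyticAt_cross ha hb)) hφa h0 h1 (by
        filter_upwards [hM, hMa, hMb, hMc, nhdsWithin_le_nhds hφ] with ζ h2 h3 h4 h5 h6
        rw [h2, ← mulVec_smul, h6, triple_product_smul_eq, h3 2 (by decide), h4 2 (by decide),
          h5 2 (by decide)]
        simp)
    convert! key using 1
    generalize (a w ⨯₃ b w) 1 = y at hab ⊢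
    rw [propagator_eq_smul x t 0 2 w, hab, smul_mulVec, mulVec_smul, smul_smul, smul_smul]
    congr 1
    field_simp

/-- Residue of the first column, given by its direction and its pairing at the origin. -/
theorem residues_lower (hT : 0 < T) (huv : IsSolution T u v) (hμ₁ : IsMu1 T u v μ₁)
    (hx : 0 ≤ x) (ht : t ∈ Icc 0 T) {b p q : ℂ → Fin 3 → ℂ}
    (hb : ∀ i, AnalyticAt ℂ (fun ζ => b ζ i) w) (hp : ∀ i, AnalyticAt ℂ (fun ζ => p ζ i) w)
    (hq : ∀ i, AnalyticAt ℂ (fun ζ => q ζ i) w) (hφ : φ =ᶠ[𝓝 w] fun ζ => b ζ ⬝ᵥ p ζ ⨯₃ q ζ)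
    (h0 : φ w = 0) (h1 : deriv φ w ≠ 0) {α β : ℂ} (hαβ : b w = α • p w + β • q w)
    (hM : ∀ᶠ ζ in 𝓝[≠] w, ∀ j, column M x t j ζ = propagator μ₁ x t j ζ *ᵥ column M 0 0 j ζ)
    (hM0 : ∀ᶠ ζ in 𝓝[≠] w, ∃ y : ℂ, column M 0 0 0 ζ = y • b ζ)
    (hM0' : ∀ᶠ ζ in 𝓝[≠] w, column M 0 0 0 ζ ⬝ᵥ p ζ ⨯₃ q ζ = 1)
    (hM1 : ∀ᶠ ζ in 𝓝[≠] w, column M 0 0 1 ζ = p ζ)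
    (hM2 : ∀ᶠ ζ in 𝓝[≠] w, column M 0 0 2 ζ = q ζ) :
    ∃ A B, HasRegularValue (column M x t 1) w A ∧ HasRegularValue (column M x t 2) w B ∧
      HasSimpleResidue (column M x t 0) w
        ((exp (θ 2 0 x t w) / deriv φ w) • (α • A + β • B)) := by
  have hprop := fun j {g : ℂ → Fin 3 → ℂ} (hg : ∀ i, AnalyticAt ℂ (fun ζ => g ζ i) w) =>
    analyticAt_propagator_mulVec hμ₁ hT huv hx ht j hg
  have hφa : AnalyticAt ℂ φ w :=
    (analyticAt_dotProduct hb (analyticAt_cross hp hq)).congr hφ.symm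
  refine ⟨_, _, hasRegularValue_of_eventuallyEq (hprop 1 hp) ?_,
    hasRegularValue_of_eventuallyEq (hprop 2 hq) ?_, ?_⟩
  · filter_upwards [hM, hM1] with ζ h2 h3
    rw [h2, h3]
  · filter_upwards [hM, hM2] with ζ h2 h3
    rw [h2, h3]
  · have key := hasSimpleResidue_of_smul_eq (f := column M x t 0) (hprop 0 hb) hφa h0 h1 (by
        filter_upwards [hM, hM0, hM0', nhdsWithin_le_nhds hφ] with ζ h2 h3 h4 h5
        obtain ⟨y, hy⟩ := h3
        rw [hy, smul_dotProduct, smul_eq_mul] at h4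
        rw [h2, ← mulVec_smul, h5, hy, smul_smul, mul_comm, h4, one_smul])
    convert! key using 1
    have h3 : propagator μ₁ x t 1 w = propagator μ₁ x t 2 w := by
      rw [propagator_eq_smul x t 2 1 w, show θ 2 1 x t w = 0 by simp [θ, l_two, z_two], exp_zero,
        one_smul]
    rw [propagator_eq_smul x t 2 0 w, h3, hαβ, smul_mulVec, mulVec_add, mulVec_smul, mulVec_smul,
      smul_smul, div_eq_inv_mul]

/-! ### The residue conditions -/

theorem l_eq_of_ne_zero {j : Fin 3} (hj : j ≠ 0) (lam : ℂ) : l lam j = l lam 1 := by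
  fin_cases j
  exacts [absurd rfl hj, rfl, rfl]

theorem z_eq_of_ne_zero {j : Fin 3} (hj : j ≠ 0) (lam : ℂ) : z lam j = z lam 1 := by
  fin_cases j
  exacts [absurd rfl hj, rfl, rfl]

theorem sectionContour_of_le {lam : ℂ} {i j : Fin 3} (h : (l lam j).re ≤ (l lam i).re) :
    sectionContour lam i j = .γ₃ := if_neg h.not_gt

theorem sectionContour_of_lt_of_le {lam : ℂ} {i j : Fin 3} (h : (l lam i).re < (l lam j).re)
    (h' : (z lam j).re ≤ (z lam i).re) : sectionContour lam i j = .γ₁ := by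
  rw [sectionContour, if_pos h, if_pos h']

theorem sectionContour_of_lt_of_lt {lam : ℂ} {i j : Fin 3} (h : (l lam i).re < (l lam j).re)
    (h' : (z lam i).re < (z lam j).re) : sectionContour lam i j = .γ₂ := by
  rw [sectionContour, if_pos h, if_neg h'.not_ge]

theorem eventually_mem_and_notMem {D E : Set ℂ} (hD : IsOpen D) (hE : E.Finite) {w : ℂ}
    (hw : w ∈ D) : ∀ᶠ ζ in 𝓝[≠] w, ζ ∈ D ∧ ζ ∉ E := by
  have h : (E \ {w})ᶜ ∈ 𝓝 w := (hE.subset sdiff_subset).isClosed.isOpen_compl.mem_nhds (by simp)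
  filter_upwards [nhdsWithin_le_nhds (hD.mem_nhds hw), nhdsWithin_le_nhds h,
    self_mem_nhdsWithin] with ζ h1 h2 h3
  exact ⟨h1, fun h4 => h2 ⟨h4, h3⟩⟩

variable {T : ℝ} {u v : ℝ → ℝ → ℂ} {μ₁ μ₃ μ₃A M : ℝ → ℝ → ℂ → Matrix (Fin 3) (Fin 3) ℂ}
  {x t : ℝ} {D E : Set ℂ} {w : ℂ}

theorem IsSectionalM.eventually_eq_propagator (hT : 0 < T) (hμ₁ : IsMu1 T u v μ₁)
    (hM : IsSectionalM T u v E M) (hx : 0 ≤ x) (ht : t ∈ Icc 0 T) (hD : IsOpen D)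
    (hE : E.Finite) (hDD : D ⊆ D₁ ∪ D₂ ∪ D₃ ∪ D₄) (hw : w ∈ D) :
    ∀ᶠ ζ in 𝓝[≠] w, ∀ j, column M x t j ζ = propagator μ₁ x t j ζ *ᵥ column M 0 0 j ζ := by
  filter_upwards [eventually_mem_and_notMem hD hE hw] with ζ hζ j
  exact hμ₁.eq_propagator_mulVec hT (hM ζ (hDD hζ.1) hζ.2 j).1.isStripSolution hx ht

/-- D₁ and D₂ differ only in the contour of the first row of the last two columns. That row supplies
the covector a; the rows on γ₃ supply the dual conditions with respect to `μ₃A`. -/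
theorem IsSectionalM.residues_upper (hT : 0 < T) (huv : IsSolution T u v)
    (hμ₁ : IsMu1 T u v μ₁) (hμ₃ : IsMu3 T u v μ₃) (hμ₃A : IsMu3A T u v μ₃A)
    (hM : IsSectionalM T u v E M) (hx : 0 ≤ x) (ht : t ∈ Icc 0 T) (hD : IsOpen D)
    (hE : E.Finite) (hDD : D ⊆ D₁ ∪ D₂ ∪ D₃ ∪ D₄) (hDu : D ⊆ upper) (hw : w ∈ D)
    {a : ℂ → Fin 3 → ℂ} (ha : ∀ i, AnalyticAt ℂ (fun ζ => a ζ i) w)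
    (hMa : ∀ ζ ∈ D, ∀ j ≠ 0, ∀ f, IsLaxColumn T u v ζ (fun i => sectionContour ζ i j) j f →
      f 0 0 ⬝ᵥ a ζ = 0)
    {φ : ℂ → ℂ} (hφ : ∀ ζ, φ ζ = a ζ ⬝ᵥ (μ₃ 0 0 ζ).col 0) (h0 : φ w = 0) (h1 : deriv φ w ≠ 0)
    (hs : μ₃ 0 0 w 1 0 ≠ 0) :
    ∃ A, HasRegularValue (column M x t 0) w A ∧
      HasSimpleResidue (column M x t 1) w
        (((μ₃A 0 0 w 2 2 * a w 0 - μ₃A 0 0 w 0 2 * a w 2) / (deriv φ w * μ₃ 0 0 w 1 0) *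
          exp (θ 0 2 x t w)) • A) ∧
      HasSimpleResidue (column M x t 2) w
        (((a w 2 * μ₃A 0 0 w 0 1 - a w 0 * μ₃A 0 0 w 2 1) / (deriv φ w * μ₃ 0 0 w 1 0) *
          exp (θ 0 2 x t w)) • A) := by
  have hev := eventually_mem_and_notMem hD hE hw
  have hcross : ∀ ζ ∈ D, (μ₃ 0 0 ζ).col 0 = (μ₃A 0 0 ζ).col 1 ⨯₃ (μ₃A 0 0 ζ).col 2 :=
    fun ζ hζ => spec_mu3_eq_cross hT huv hμ₃ hμ₃A (hDu hζ)
  have hana : ∀ j ≠ 0, ∀ i, AnalyticAt ℂ (fun ζ => (μ₃A 0 0 ζ).col j i) w := fun j hj i =>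
    (differentiableOn_spec_mu3A hT huv hμ₁ hμ₃A hj i).analyticAt
      (isOpen_upper.mem_nhds (hDu hw))
  have hpair : ∀ j' ≠ 0, ∀ᶠ ζ in 𝓝[≠] w, ∀ j ≠ 0,
      column M 0 0 j ζ ⬝ᵥ (μ₃A 0 0 ζ).col j' = if j' = j then 1 else 0 := by
    intro j' hj'
    filter_upwards [hev] with ζ hζ j hj
    obtain ⟨h2, h3⟩ := hM ζ (hDD hζ.1) hζ.2 j
    exact h2.pairing_spec_mu3A hT huv hμ₃A (re_l_le_of_ne_zero (hDu hζ.1) hj')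
      ((l_eq_of_ne_zero hj ζ).trans (l_eq_of_ne_zero hj' ζ).symm) h3
      (sectionContour_of_le (re_l_le_of_ne_zero (hDu hζ.1) hj' j))
  have h2 : (2 : Fin 3) ≠ 0 := by decide
  have hs' : ((μ₃A 0 0 w).col 1 ⨯₃ (μ₃A 0 0 w).col 2) 1 = μ₃ 0 0 w 1 0 := by
    rw [← hcross w hw]
    rfl
  obtain ⟨A, hA⟩ := CMNLS.residues_upper (φ := φ) (M := M) hT huv hμ₁ hx ht ha
    (hana 1 one_ne_zero) (hana 2 h2)
    (by
      filter_upwards [hD.mem_nhds hw] with ζ hζ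
      rw [hφ, hcross ζ hζ])
    h0 h1 (by rwa [hs'])
    (hM.eventually_eq_propagator hT hμ₁ hx ht hD hE hDD hw)
    (by
      filter_upwards [hev] with ζ hζ
      obtain ⟨h3, h4⟩ := hM ζ (hDD hζ.1) hζ.2 0
      rw [← hcross ζ hζ.1]
      exact h3.eq_spec_mu3 hT huv hμ₃ (re_l_zero_le (hDu hζ.1)) h4
        fun i => sectionContour_of_le (re_l_zero_le (hDu hζ.1) i))
    (by
      filter_upwards [hev] with ζ hζ j hj
      exact hMa ζ hζ.1 j hj _ (hM ζ (hDD hζ.1) hζ.2 j).1)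
    (hpair 1 one_ne_zero) (hpair 2 h2)
  rw [hs'] at hA
  exact ⟨A, hA⟩

/-- D₃ and D₄ differ only in the contours of the last two rows of the first column. These rows fix
its direction b at the origin, and the first row, on γ₃, fixes its length. -/
theorem IsSectionalM.residues_lower (hT : 0 < T) (huv : IsSolution T u v)
    (hμ₁ : IsMu1 T u v μ₁) (hμ₃ : IsMu3 T u v μ₃) (hμ₃A : IsMu3A T u v μ₃A)
    (hM : IsSectionalM T u v E M) (hx : 0 ≤ x) (ht : t ∈ Icc 0 T) (hD : IsOpen D)
    (hE : E.Finite) (hDD : D ⊆ D₁ ∪ D₂ ∪ D₃ ∪ D₄) (hDl : D ⊆ lower) (hw : w ∈ D)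
    {b : ℂ → Fin 3 → ℂ} (hb : ∀ i, AnalyticAt ℂ (fun ζ => b ζ i) w)
    (hMb : ∀ ζ ∈ D, ∀ f, IsLaxColumn T u v ζ (fun i => sectionContour ζ i 0) 0 f →
      ∃ y : ℂ, f 0 0 = y • b ζ)
    {φ : ℂ → ℂ} (hφ : ∀ ζ, φ ζ = b ζ ⬝ᵥ (μ₃A 0 0 ζ).col 0) (h0 : φ w = 0)
    (h1 : deriv φ w ≠ 0) {α β : ℂ}
    (hαβ : b w = α • (μ₃ 0 0 w).col 1 + β • (μ₃ 0 0 w).col 2) :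
    ∃ A B, HasRegularValue (column M x t 1) w A ∧ HasRegularValue (column M x t 2) w B ∧
      HasSimpleResidue (column M x t 0) w
        ((exp (θ 2 0 x t w) / deriv φ w) • (α • A + β • B)) := by
  have hev := eventually_mem_and_notMem hD hE hw
  have hcross : ∀ ζ ∈ D, (μ₃A 0 0 ζ).col 0 = (μ₃ 0 0 ζ).col 1 ⨯₃ (μ₃ 0 0 ζ).col 2 :=
    fun ζ hζ => spec_mu3A_eq_cross hT huv hμ₃ hμ₃A (hDl hζ)
  have hana : ∀ j ≠ 0, ∀ i, AnalyticAt ℂ (fun ζ => (μ₃ 0 0 ζ).col j i) w := fun j hj i =>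
    (differentiableOn_spec_mu3 hT huv hμ₁ hμ₃ hj i).analyticAt (isOpen_lower.mem_nhds (hDl hw))
  have hcol : ∀ j ≠ 0, ∀ᶠ ζ in 𝓝[≠] w, column M 0 0 j ζ = (μ₃ 0 0 ζ).col j := by
    intro j hj
    filter_upwards [hev] with ζ hζ
    obtain ⟨h3, h4⟩ := hM ζ (hDD hζ.1) hζ.2 j
    exact h3.eq_spec_mu3 hT huv hμ₃ (re_l_ge_of_ne_zero (hDl hζ.1) hj) h4
      fun i => sectionContour_of_le (re_l_ge_of_ne_zero (hDl hζ.1) hj i)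
  have h2 : (2 : Fin 3) ≠ 0 := by decide
  exact CMNLS.residues_lower (φ := φ) (M := M) hT huv hμ₁ hx ht hb
    (hana 1 one_ne_zero) (hana 2 h2)
    (by
      filter_upwards [hD.mem_nhds hw] with ζ hζ
      rw [hφ, hcross ζ hζ])
    h0 h1 hαβ
    (hM.eventually_eq_propagator hT hμ₁ hx ht hD hE hDD hw)
    (by
      filter_upwards [hev] with ζ hζ
      exact hMb ζ hζ.1 _ (hM ζ (hDD hζ.1) hζ.2 0).1)
    (by
      filter_upwards [hev] with ζ hζ
      obtain ⟨h3, h4⟩ := hM ζ (hDD hζ.1) hζ.2 0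
      rw [← hcross ζ hζ.1]
      exact (h3.pairing_spec_mu3A hT huv hμ₃A (re_l_le_zero (hDl hζ.1)) rfl h4
        (sectionContour_of_le le_rfl)).trans (if_pos rfl))
    (hcol 1 one_ne_zero) (hcol 2 h2)

end CMNLS

/-! ### Choice of the auxiliary vectors in each of the four domains. -/

open CMNLS in
theorem proposition2p8 (T : ℝ) (hT : 0 < T) (u v : ℝ → ℝ → ℂ) (huv : CMNLS.IsSolution T u v)
    (μ₁ μ₃ μ₃A M : ℝ → ℝ → ℂ → Matrix (Fin 3) (Fin 3) ℂ)
    (hμ₁ : CMNLS.IsMu1 T u v μ₁) (hμ₃ : CMNLS.IsMu3 T u v μ₃) (hμ₃A : CMNLS.IsMu3A T u v μ₃A)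
    (s S sA : ℂ → Matrix (Fin 3) (Fin 3) ℂ)
    (hs : s = CMNLS.spec μ₃) (hS : S = CMNLS.spec μ₁) (hsA : sA = CMNLS.spec μ₃A)
    (m : Fin 3 → Fin 3 → ℂ → ℂ) (hm : m = CMNLS.minorOf sA)
    (n₀ n₁ n₂ N : ℕ) (lam : ℕ → ℂ) (hlam : CMNLS.ZeroAssumption s S sA n₀ n₁ n₂ N lam)
    (hM : CMNLS.IsSectionalM T u v (lam '' Set.Icc 1 N) M)
    (x t : ℝ) (hx : 0 ≤ x) (ht : t ∈ Set.Icc 0 T) :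
    (∀ j ∈ Set.Icc 1 n₀, s (lam j) 1 0 ≠ 0 →
      ∃ a : Fin 3 → ℂ, CMNLS.HasRegularValue (CMNLS.column M x t 0) (lam j) a ∧
        CMNLS.HasSimpleResidue (CMNLS.column M x t 1) (lam j)
          (((m 2 2 (lam j) * CMNLS.minor (S (lam j)) 0 0
              - m 0 2 (lam j) * CMNLS.minor (S (lam j)) 2 0)
            / (deriv (CMNLS.sTSA s S) (lam j) * s (lam j) 1 0)
            * Complex.exp (CMNLS.θ 0 2 x t (lam j))) • a) ∧
        CMNLS.HasSimpleResidue (CMNLS.column M x t 2) (lam j)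
          (((m 2 1 (lam j) * CMNLS.minor (S (lam j)) 0 0
              - m 0 1 (lam j) * CMNLS.minor (S (lam j)) 2 0)
            / (deriv (CMNLS.sTSA s S) (lam j) * s (lam j) 1 0)
            * Complex.exp (CMNLS.θ 0 2 x t (lam j))) • a)) ∧
    (∀ j ∈ Set.Ioc n₀ n₁, s (lam j) 1 0 ≠ 0 →
      ∃ a : Fin 3 → ℂ, CMNLS.HasRegularValue (CMNLS.column M x t 0) (lam j) a ∧
        CMNLS.HasSimpleResidue (CMNLS.column M x t 1) (lam j)
          ((m 2 2 (lam j) / (deriv (fun w => s w 0 0) (lam j) * s (lam j) 1 0)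
            * Complex.exp (CMNLS.θ 0 2 x t (lam j))) • a) ∧
        CMNLS.HasSimpleResidue (CMNLS.column M x t 2) (lam j)
          ((m 2 1 (lam j) / (deriv (fun w => s w 0 0) (lam j) * s (lam j) 1 0)
            * Complex.exp (CMNLS.θ 0 2 x t (lam j))) • a)) ∧
    (∀ j ∈ Set.Ioc n₁ n₂, m 1 0 (lam j) ≠ 0 →
      ∃ a b : Fin 3 → ℂ, CMNLS.HasRegularValue (CMNLS.column M x t 1) (lam j) a ∧
        CMNLS.HasRegularValue (CMNLS.column M x t 2) (lam j) b ∧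
        CMNLS.HasSimpleResidue (CMNLS.column M x t 0) (lam j)
          ((Complex.exp (CMNLS.θ 2 0 x t (lam j))
              / (deriv (m 0 0) (lam j) * m 1 0 (lam j)))
            • (s (lam j) 2 2 • a - s (lam j) 2 1 • b))) ∧
    (∀ j ∈ Set.Ioc n₂ N, m 0 0 (lam j) ≠ 0 →
      ∃ a b : Fin 3 → ℂ, CMNLS.HasRegularValue (CMNLS.column M x t 1) (lam j) a ∧
        CMNLS.HasRegularValue (CMNLS.column M x t 2) (lam j) b ∧
        CMNLS.HasSimpleResidue (CMNLS.column M x t 0) (lam j)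
          (((s (lam j) 2 2 * S (lam j) 1 0 - s (lam j) 1 2 * S (lam j) 2 0)
              / (deriv (CMNLS.STsA S sA) (lam j) * m 0 0 (lam j))
              * Complex.exp (CMNLS.θ 2 0 x t (lam j))) • a
            + ((s (lam j) 1 1 * S (lam j) 2 0 - s (lam j) 2 1 * S (lam j) 1 0)
              / (deriv (CMNLS.STsA S sA) (lam j) * m 0 0 (lam j))
              * Complex.exp (CMNLS.θ 2 0 x t (lam j))) • b)) := by
  subst hs hS hsA hm
  have hE : (lam '' Icc 1 N).Finite := (finite_Icc 1 N).image lam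
  have h00 : (0 : ℝ) ∈ Icc 0 T := ⟨le_rfl, hT.le⟩
  refine ⟨fun j hj hne => ?_, fun j hj hne => ?_, fun j hj hne => ?_, fun j hj hne => ?_⟩
  · obtain ⟨hD, h0⟩ : lam j ∈ D₁ ∧ sTSA (spec μ₃) (spec μ₁) (lam j) = 0 := by
      have := hlam.zeros₁.zeros.symm.subset (mem_image_of_mem lam hj)
      exact this
    -- In D₁ the first row is on γ₁, so the covector is the first column of the cofactor matrix of
    -- S.
    obtain ⟨A, h1, h2, h3⟩ := hM.residues_upper (φ := sTSA (spec μ₃) (spec μ₁))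
      (a := fun ζ => (cofactor (μ₁ 0 0 ζ)).col 0) hT huv hμ₁ hμ₃ hμ₃A hx ht isOpen_D₁ hE
      (fun ζ hζ => Or.inl (Or.inl (Or.inl hζ))) (fun ζ hζ => hζ.1) hD
      (fun i => (hμ₁.differentiable_cofactor hT huv le_rfl h00 i 0).analyticAt _)
      (fun ζ hζ i hi f hf => hf.pairing_cofactor hT hμ₁ hi.symm
        (sectionContour_of_lt_of_le (by rw [l_eq_of_ne_zero hi]; exact hζ.1)
          (by rw [z_eq_of_ne_zero hi]; exact hζ.2.le)))
      (fun ζ => by simp [sTSA, spec, mul_apply, dotProduct, Matrix.col_apply, mul_comm]) h0 (hlam.zeros₁.simple j hj) hne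
    refine ⟨A, h1, ?_, ?_⟩
    · convert! h2 using 4
      norm_num [minorOf, spec, cofactor, Matrix.col_apply]
    · convert! h3 using 4
      simp [minorOf, spec, cofactor, Matrix.col_apply]
      ring
  · obtain ⟨hD, h0⟩ : lam j ∈ D₂ ∧ spec μ₃ (lam j) 0 0 = 0 := by
      have := hlam.zeros₂.zeros.symm.subset (mem_image_of_mem lam hj)
      exact this
    -- In D₂ the first row is on γ₂, so its entry vanishes at the origin and the covector is the
    -- first unit vector.
    obtain ⟨A, h1, h2, h3⟩ := hM.residues_upper (φ := fun ζ => spec μ₃ ζ 0 0)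
      (a := fun _ => Pi.single 0 1) hT huv hμ₁ hμ₃ hμ₃A hx ht isOpen_D₂ hE
      (fun ζ hζ => Or.inl (Or.inl (Or.inr hζ))) (fun ζ hζ => hζ.1) hD
      (fun i => analyticAt_const)
      (fun ζ hζ i hi f hf => by
        rw [dotProduct_single_one]
        exact (hf.apply_zero hT (sectionContour_of_lt_of_lt (by rw [l_eq_of_ne_zero hi]; exact hζ.1)
          (by rw [z_eq_of_ne_zero hi]; exact hζ.2))).trans (if_neg hi.symm))
      (fun ζ => by simp [spec]) h0 (hlam.zeros₂.simple j hj) hne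
    refine ⟨A, h1, ?_, ?_⟩
    · convert! h2 using 4
      simp [minorOf, spec]
      norm_num
    · convert! h3 using 4
      simp [minorOf, spec]
      norm_num
  · obtain ⟨hD, h0⟩ : lam j ∈ D₃ ∧ minorOf (spec μ₃A) 0 0 (lam j) = 0 := by
      have := hlam.zeros₃.zeros.symm.subset (mem_image_of_mem lam hj)
      exact this
    have hcross := spec_mu3A_eq_cross hT huv hμ₃ hμ₃A (lam := lam j) hD.1
    have hc0 := congrFun hcross 0
    have hc1 := congrFun hcross 1
    simp only [cross_apply, Matrix.cons_val, Matrix.col_apply] at hc0 hc1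
    have h0' : μ₃A 0 0 (lam j) 0 0 = 0 := by simpa [minorOf, spec] using h0
    have hm10 : minorOf (spec μ₃A) 1 0 (lam j) = -μ₃A 0 0 (lam j) 1 0 := by simp [minorOf, spec]
    -- The weights (s₃₃, -s₃₂) cancel the third entry of the combination of the last two columns of
    -- s. The second entry is then m₁₁ = 0 and the first is m₂₁, whence the normalization by m₂₁.
    obtain ⟨A, B, h1, h2, h3⟩ := hM.residues_lower (φ := minorOf (spec μ₃A) 0 0)
      (α := spec μ₃ (lam j) 2 2 / minorOf (spec μ₃A) 1 0 (lam j))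
      (β := -spec μ₃ (lam j) 2 1 / minorOf (spec μ₃A) 1 0 (lam j))
      (b := fun _ => Pi.single 0 1) hT huv hμ₁ hμ₃ hμ₃A hx ht isOpen_D₃ hE
      (fun ζ hζ => Or.inl (Or.inr hζ)) (fun ζ hζ => hζ.1) hD
      (fun i => analyticAt_const)
      (fun ζ hζ f hf => by
        have hi : ∀ i ≠ 0, f 0 0 i = 0 := fun i hi =>
          (hf.apply_zero hT (sectionContour_of_lt_of_lt (by rw [l_eq_of_ne_zero hi]; exact hζ.1)
            (by rw [z_eq_of_ne_zero hi]; exact hζ.2))).trans (if_neg hi)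
        refine ⟨f 0 0 0, ?_⟩
        ext i
        by_cases h : i = 0
        · simp [h]
        · simp [h, hi i h])
      (fun ζ => by simp [minorOf, spec]) h0 (hlam.zeros₃.simple j hj)
      (by
        ext i
        simp only [Pi.add_apply, Pi.smul_apply, smul_eq_mul, Matrix.col_apply, spec]
        field_simp
        rw [hm10]
        fin_cases i <;> simp only [Fin.zero_eta, Fin.mk_one, Fin.reduceFinMk, Pi.single_eq_same,
          Pi.single_apply]
        · linear_combination -hc1
        · simp
          linear_combination -h0' + hc0
        · simp
          ring)
    refine ⟨A, B, h1, h2, ?_⟩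
    convert! h3 using 1
    simp only [smul_add, smul_smul, sub_eq_add_neg, ← neg_smul]
    congr 2 <;> ring
  · obtain ⟨hD, h0⟩ : lam j ∈ D₄ ∧ STsA (spec μ₁) (spec μ₃A) (lam j) = 0 := by
      have := hlam.zeros₄.zeros.symm.subset (mem_image_of_mem lam hj)
      exact this
    have hcross := spec_mu3A_eq_cross hT huv hμ₃ hμ₃A (lam := lam j) hD.1
    have hc0 := congrFun hcross 0
    have hc1 := congrFun hcross 1
    have hc2 := congrFun hcross 2
    simp only [cross_apply, Matrix.cons_val, Matrix.col_apply] at hc0 hc1 hc2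
    have hm00 : minorOf (spec μ₃A) 0 0 (lam j) = μ₃A 0 0 (lam j) 0 0 := by simp [minorOf, spec]
    have h0' : μ₁ 0 0 (lam j) 0 0 * μ₃A 0 0 (lam j) 0 0 + μ₁ 0 0 (lam j) 1 0 * μ₃A 0 0 (lam j) 1 0
        + μ₁ 0 0 (lam j) 2 0 * μ₃A 0 0 (lam j) 2 0 = 0 := by
      simpa [STsA, spec, mul_apply, Fin.sum_univ_three] using h0
    -- The coefficients solve the last two rows of b = αp + βq by Cramer's rule with determinant
    -- m₁₁. The first row then holds because (Sᵀsᴬ)₁₁ vanishes.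
    obtain ⟨A, B, h1, h2, h3⟩ := hM.residues_lower (φ := STsA (spec μ₁) (spec μ₃A))
      (α := (spec μ₃ (lam j) 2 2 * spec μ₁ (lam j) 1 0 - spec μ₃ (lam j) 1 2 *
        spec μ₁ (lam j) 2 0) / minorOf (spec μ₃A) 0 0 (lam j))
      (β := (spec μ₃ (lam j) 1 1 * spec μ₁ (lam j) 2 0 - spec μ₃ (lam j) 2 1 *
        spec μ₁ (lam j) 1 0) / minorOf (spec μ₃A) 0 0 (lam j))
      (b := fun ζ => (μ₁ 0 0 ζ).col 0) hT huv hμ₁ hμ₃ hμ₃A hx ht isOpen_D₄ hE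
      (fun ζ hζ => Or.inr hζ) (fun ζ hζ => hζ.1) hD
      (fun i => (hμ₁.differentiable_apply hT huv le_rfl h00 i 0).analyticAt _)
      (fun ζ hζ f hf => by
        have hi : ∀ i ≠ 0, f 0 0 ⬝ᵥ (cofactor (μ₁ 0 0 ζ)).col i = 0 := fun i hi =>
          hf.pairing_cofactor hT hμ₁ hi
            (sectionContour_of_lt_of_le (by rw [l_eq_of_ne_zero hi]; exact hζ.1)
              (by rw [z_eq_of_ne_zero hi]; exact hζ.2.le))
        refine ⟨f 0 0 ⬝ᵥ (cofactor (μ₁ 0 0 ζ)).col 0, ?_⟩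
        -- Orthogonality to the last two cofactor columns leaves one coordinate with respect to the
        -- columns of S, so multiplication by S gives a multiple of its first column.
        have hsingle : (cofactor (μ₁ 0 0 ζ))ᵀ *ᵥ f 0 0 =
            Pi.single 0 (f 0 0 ⬝ᵥ (cofactor (μ₁ 0 0 ζ)).col 0) := by
          ext i
          have h1 : ((cofactor (μ₁ 0 0 ζ))ᵀ *ᵥ f 0 0) i = f 0 0 ⬝ᵥ (cofactor (μ₁ 0 0 ζ)).col i :=
            dotProduct_comm _ _
          rw [h1]
          by_cases h : i = 0
          · simp [h]
          · simp [h, hi i h]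
        have h2 := congrArg (μ₁ 0 0 ζ *ᵥ ·) hsingle
        simp only [mulVec_mulVec, mul_transpose_cofactor, hμ₁.det_eq_one hT ζ le_rfl h00, one_smul,
          one_mulVec, mulVec_single, op_smul_eq_smul] at h2
        exact h2)
      (fun ζ => rfl) h0 (hlam.zeros₄.simple j hj)
      (by
        ext i
        simp only [Pi.add_apply, Pi.smul_apply, smul_eq_mul, Matrix.col_apply, spec]
        field_simp
        rw [hm00]
        fin_cases i <;> simp only [Fin.zero_eta, Fin.mk_one, Fin.reduceFinMk]
        · linear_combination h0' - μ₁ 0 0 (lam j) 1 0 * hc1 - μ₁ 0 0 (lam j) 2 0 * hc2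
        · linear_combination μ₁ 0 0 (lam j) 1 0 * hc0
        · linear_combination μ₁ 0 0 (lam j) 2 0 * hc0)
    refine ⟨A, B, h1, h2, ?_⟩
    convert! h3 using 1
    simp only [smul_add, smul_smul]
    congr 2 <;> ring
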